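/- **Setting.** Fix a horizon $T\ge1$, a prompt $s_0$, discrete state spaces $\mathcal S_1,\dots,\mathcal S_T$ with prefix spaces $\mathcal S_{1:t}=\mathcal S_1\times\cdots\times\mathcal S_t$ ($\mathcal S_{1:0}=\{\varnothing\}$), a base model given by probability distributions $\pi_{\rm ref}(\cdot\mid s_0,s_{1:t})$ on $\mathcal S_{t+1}$, and a reward model $\hat V(s_0,s_{1:t})>0$. Put $Z_{t+1}(s_{1:t})=\mathbb E_{x\sim\pi_{\rm ref}(\cdot\mid s_0,s_{1:t})}[\hat V(s_0,(s_{1:t},x))]$, and let the target be $\tilde\pi_T(s_{1:T})\propto\prod_{t=1}^T\pi_{\rm ref}(s_t\mid s_0,s_{1:t-1})\cdot\hat V(s_0,s_{1:T})$. Let $\|\mu-\nu\|_{\rm TV}=\sup_A|\mu(A)-\nu(A)|$. **Assumptions.** For all $0\le t<T$ and all prefixes, (A1) $\hat V(s_0,s_{1:t})/\hat V(s_0,s_{1:t+1})\le L$ and $\hat V(s_0,s_{1:t+1})/\hat V(s_0,s_{1:t})\le L$, where $L\ge1$; (A2) $\hat V(s_0,s_{1:t})/Z_{t+1}(s_{1:t})\le1+\varepsilon$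 and $Z_{t+1}(s_{1:t})/\hat V(s_0,s_{1:t})\le1+\varepsilon$, where $\varepsilon>0$. **Subroutines.** $\widehat{\mathbb E}(s_{1:t})$ is the average of $\hat V(s_0,(s_{1:t},x_i))$ over $N_m$ fresh i.i.d. samples $x_i\sim\pi_{\rm ref}(\cdot\mid s_0,s_{1:t})$. $\mathrm{RS}(g,\mu,M,\delta')$: set $N=\lceil4M\log(4/\delta')\rceil$, let $\hat Z$ be the average of $g$ over $N$ i.i.d. samples of $\mu$; then up to $N$ times draw $z\sim\mu$ and return $z$ with probability $\min\{g(z)/(M\hat Z),1\}$; if nothing was returned, return a fresh $z\sim\mu$. **Algorithm** (rejection-based SP-gSMC with Metropolis–Hastings correction; parameters $H,N_m\ge1$, $M$, $\delta'$). For $h=1,\dots,H$: set $w=w'=1$; for $t=1,\dots,T$ draw $s_t$ by $\mathrm{RS}(\hat V(s_0,(s_{1:t-1},\cdot)),\pi_{\rm ref}(\cdot\mid s_0,s_{1:t-1}),M,\delta')$, multiply $w$ by $\hat V(s_0,s_{1:t})/\widehat{\mathbb E}(s_{1:t-1})$ and, if $h\ge2$, multiply $w'$ by $\hat V(s_0,s^{\rm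 acc}_{1:t})/\widehat{\mathbb E}(s^{\rm acc}_{1:t-1})$. If $h=1$, set $s^{\rm acc}_{1:T}=s_{1:T}$. If $h\ge2$, draw $\alpha\sim\mathrm{Unif}[0,1]$ and, if $\alpha<\frac{w'}{\hat V(s_0,s^{\rm acc}_{1:T})}\cdot\frac{\hat V(s_0,s_{1:T})}{w}$, set $s^{\rm acc}_{1:T}=s_{1:T}$. Output $s^{\rm acc}_{1:T}$. Its running time counts every random draw, every evaluation of $\hat V$ and every arithmetic operation as one unit. **Theorem.** For all constants $\kappa,c_0>0$ there are $C>0$ and $p\in\mathbb N$, depending only on $\kappa$ and $c_0$, such that for all $T\ge1$, $L\ge1$, $0<\varepsilon\le\kappa/T$, $0<\delta_{\rm TV}\le1$ and $0<\delta\le\min\{c_0\delta_{\rm TV},\tfrac12\}$ there are parameters $H,N_m\ge1$, $L(1+\varepsilon)<M\le CL$ and $0<\delta'<1$ with $\delta'\le C\delta/(T\log(1/\delta))$, depending only on $(\kappa,c_0,T,L,\varepsilon,\delta,\delta_{\rm TV})$, for which the following holds for all state spaces, base models, reward models and prompts that satisfy (A1) and (A2): every execution of the algorithm takes time at most $$C\,\frac{L\,T^3\log(1/\delta)}{\delta_{\rm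 TV}^2}\,\bigl(1+\log(T/\delta_{\rm TV})\bigr)^p ,$$ and there is an event $\mathcal E$ in the probability space of executions with $\mathbb P(\mathcal E)\ge1-\delta$ such that the law $\hat\pi_T|_{\mathcal E}$ of the output conditioned on $\mathcal E$ satisfies $\|\tilde\pi_T-\hat\pi_T|_{\mathcal E}\|_{\rm TV}\le\delta_{\rm TV}$. -/

import Mathlib

open scoped ENNReal

noncomputable section

/-! ### Randomised programs, their executions, laws and running times -/

/-- A randomised program returning a value of type `α`. It can draw a sample from a discrete
distribution (one unit of time) or spend one unit of time on a deterministic elementary operation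
(an evaluation of the reward model, or an arithmetic operation on real numbers). -/
inductive Prog (α : Type) : Type 1
  | ret (a : α) : Prog α
  | draw {Z : Type} (μ : PMF Z) (next : Z → Prog α) : Prog α
  | tick (next : Prog α) : Prog α

namespace Prog

/-- Sequential composition. -/
def bind {α β : Type} : Prog α → (α → Prog β) → Prog β
  | ret a, f => f a
  | draw μ next, f => draw μ (fun z => (next z).bind f)
  | tick next, f => tick (next.bind f)

instance : Monad Prog where
  pure := ret
  bind := bind

/-- The sample space of a program: an execution is the sequence of the outcomes of all its draws. -/
def Run {α : Type} : Prog α → Type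
  | ret _ => Unit
  | draw (Z := Z) _ next => (z : Z) × (next z).Run
  | tick next => next.Run

/-- The probability distribution on executions. -/
def law {α : Type} : (p : Prog α) → PMF p.Run
  | ret _ => PMF.pure ()
  | draw μ next => μ.bind fun z => (next z).law.map fun r => ⟨z, r⟩
  | tick next => next.law

/-- The value returned by an execution. -/
def output {α : Type} : (p : Prog α) → p.Run → α
  | ret a, _ => a
  | draw _ next, r => (next r.1).output r.2
  | tick next, r => next.output r

/-- The time taken by an execution. -/
def time {α : Type} : (p : Prog α) → p.Run → ℕ
  | ret _, _ => 0
  | draw _ next, r => (next r.1).time r.2 + 1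
  | tick next, r => next.time r + 1

/-- One draw from `μ`. -/
def sample {Z : Type} (μ : PMF Z) : Prog Z := draw μ ret

/-- Return `a`, at the cost of one unit of time. -/
def charge {α : Type} (a : α) : Prog α := tick (ret a)

/-- The Bernoulli distribution with parameter `min {r, 1}` (and `0` if `r < 0`). -/
def bernoulli (r : ℝ) : PMF Bool :=
  PMF.ofFintype
    (fun b => if b then min (ENNReal.ofReal r) 1 else 1 - min (ENNReal.ofReal r) 1)
    (by simp [add_tsub_cancel_of_le])

/-- A Bernoulli variable that is `true` with probability `min {r, 1}` (and `0` if `r < 0`);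
this is also the outcome of the test `α < r` for `α` uniform on `[0, 1]`. -/
def coin (r : ℝ) : Prog Bool := sample (bernoulli r)

/-- The law of the output of `p`, conditioned on the event `E` (of positive probability). -/
def outputGiven {α : Type} (p : Prog α) (E : Set p.Run) (hE : ∃ r ∈ E, r ∈ p.law.support) :
    PMF α :=
  (p.law.filter E hE).map p.output

end Prog

/-- The probability of the event `A`. -/
def prob {Ω : Type} (μ : PMF Ω) (A : Set Ω) : ℝ := (μ.toOuterMeasure A).toReal

/-- Total variation distance: `sup_A |μ(A) - ν(A)|`. -/
def tvDist {Ω : Type} (μ ν : PMF Ω) : ℝ := ⨆ A : Set Ω, |prob μ A - prob ν A|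

/-! ### Reasoning models -/

/-- The prefix space `S_{1:t}`, where `S_{1:0}` is a point and `S_{1:t+1} = S_{1:t} × S_{t+1}`. -/
def Prefix (S : ℕ → Type) : ℕ → Type
  | 0 => Unit
  | t + 1 => Prefix S t × S (t + 1)

/-- An autoregressive base model and a positive reward model on prefixes;
`S 0` is the prompt space and `S t` the reasoning state space at step `t ≥ 1`. -/
structure ReasoningModel (S : ℕ → Type) where
  /-- `ref s₀ t s` is the conditional law `π_ref(· | s₀, s_{1:t})` of the next step. -/
  ref : S 0 → (t : ℕ) → Prefix S t → PMF (S (t + 1))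
  /-- `V s₀ t s` is the score of the prefix `s = s_{1:t}`. -/
  V : S 0 → (t : ℕ) → Prefix S t → ℝ
  V_pos : ∀ s₀ t s, 0 < V s₀ t s

namespace ReasoningModel

variable {S : ℕ → Type} (m : ReasoningModel S) (s₀ : S 0)

/-- The law `π_ref(s_{1:t} | s₀)` of the prefix of length `t` under the base model. -/
def refPath : (t : ℕ) → PMF (Prefix S t)
  | 0 => PMF.pure ()
  | t + 1 => (refPath t).bind fun s => (m.ref s₀ t s).map fun x => (s, x)

/-- Reward model ratio bound with constant `L` for consecutive prefixes up to the horizon `T`. -/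
def RatioBound (T : ℕ) (L : ℝ) : Prop :=
  ∀ t < T, ∀ (s : Prefix S t) (x : S (t + 1)),
    m.V s₀ t s / m.V s₀ (t + 1) (s, x) ≤ L ∧ m.V s₀ (t + 1) (s, x) / m.V s₀ t s ≤ L

/-- The expected next score `E_{s_{t+1} ∼ π_ref(· | s₀, s_{1:t})} [V(s₀, s_{1:t+1})]`. -/
def nextValue (t : ℕ) (s : Prefix S t) : ℝ :=
  ∑' x, (m.ref s₀ t s x).toReal * m.V s₀ (t + 1) (s, x)

/-- Uniform Bellman error bound `ε` for all prefixes that can be extended within the horizon. -/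
def BellmanBound (T : ℕ) (ε : ℝ) : Prop :=
  ∀ t < T, ∀ s : Prefix S t,
    m.V s₀ t s / m.nextValue s₀ t s ≤ 1 + ε ∧ m.nextValue s₀ t s / m.V s₀ t s ≤ 1 + ε

/-- The unnormalised target `π_ref(s_{1:T} | s₀) V(s₀, s_{1:T})`. -/
def weight (T : ℕ) (s : Prefix S T) : ℝ≥0∞ :=
  m.refPath s₀ T s * ENNReal.ofReal (m.V s₀ T s)

theorem tsum_weight_ne_zero (T : ℕ) : ∑' s, m.weight s₀ T s ≠ 0 := by
  obtain ⟨s, hs⟩ := (m.refPath s₀ T).support_nonempty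
  intro h
  have h1 := ENNReal.tsum_eq_zero.1 h s
  rw [weight, mul_eq_zero] at h1
  rcases h1 with h1 | h1
  · exact (PMF.mem_support_iff _ _).1 hs h1
  · exact absurd (ENNReal.ofReal_eq_zero.1 h1) (not_le.2 (m.V_pos s₀ T s))

variable {m s₀}

theorem RatioBound.V_le {T : ℕ} {L : ℝ} (h : m.RatioBound s₀ T L) :
    ∀ t ≤ T, ∀ s : Prefix S t, m.V s₀ t s ≤ |L| ^ t * m.V s₀ 0 ()
  | 0, _, s => by simp; exact le_of_eq rfl
  | t + 1, ht, (s, x) => by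
    have h1 := (h t ht s x).2
    rw [div_le_iff₀ (m.V_pos _ _ _)] at h1
    calc m.V s₀ (t + 1) (s, x) ≤ L * m.V s₀ t s := h1
      _ ≤ |L| * m.V s₀ t s := mul_le_mul_of_nonneg_right (le_abs_self L) (m.V_pos _ _ _).le
      _ ≤ |L| * (|L| ^ t * m.V s₀ 0 ()) :=
        mul_le_mul_of_nonneg_left (RatioBound.V_le h t (by omega) s) (abs_nonneg L)
      _ = |L| ^ (t + 1) * m.V s₀ 0 () := by ring

theorem RatioBound.tsum_weight_ne_top {T : ℕ} {L : ℝ} (h : m.RatioBound s₀ T L) :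
    ∑' s, m.weight s₀ T s ≠ ∞ := by
  refine ne_top_of_le_ne_top (b := ENNReal.ofReal (|L| ^ T * m.V s₀ 0 ())) ENNReal.ofReal_ne_top ?_
  calc ∑' s, m.weight s₀ T s
      ≤ ∑' s, m.refPath s₀ T s * ENNReal.ofReal (|L| ^ T * m.V s₀ 0 ()) :=
        ENNReal.tsum_le_tsum fun s => by
          unfold weight
          gcongr
          exact h.V_le T le_rfl s
    _ = ENNReal.ofReal (|L| ^ T * m.V s₀ 0 ()) := by
        rw [ENNReal.tsum_mul_right, PMF.tsum_coe, one_mul]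

variable (m s₀)

/-- The reward-tilted target `π̃_T(s_{1:T} | s₀) ∝ π_ref(s_{1:T} | s₀) V(s₀, s_{1:T})`;
the ratio bound serves only to make the normalising constant finite. -/
def target (T : ℕ) {L : ℝ} (h : m.RatioBound s₀ T L) : PMF (Prefix S T) :=
  PMF.normalize (m.weight s₀ T) (m.tsum_weight_ne_zero s₀ T) h.tsum_weight_ne_top

end ReasoningModel

/-! ### The algorithm -/

/-- The sum of `n` evaluations of the score `g` at independent samples from `μ`. -/
def sumScores {Z : Type} (g : Z → ℝ) (μ : PMF Z) : ℕ → Prog ℝ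
  | 0 => pure 0
  | n + 1 => do
    let z ← Prog.sample μ
    let v ← Prog.charge (g z)
    let a ← sumScores g μ n
    Prog.charge (a + v)

/-- Empirical expectation of `g` from `n` independent samples of `μ`. -/
def empiricalMean {Z : Type} (g : Z → ℝ) (μ : PMF Z) (n : ℕ) : Prog ℝ := do
  let a ← sumScores g μ n
  Prog.charge (a / n)

/-- At most `n` accept-reject trials: a sample `z` of `μ` is accepted with probability
`min {g z / c, 1}`; if all of them fail, an unconditional sample of `μ` is returned. -/
def acceptReject {Z : Type} (g : Z → ℝ) (μ : PMF Z) (c : ℝ) : ℕ → Prog Z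
  | 0 => Prog.sample μ
  | n + 1 => do
    let z ← Prog.sample μ
    let v ← Prog.charge (g z)
    let q ← Prog.charge (v / c)
    let b ← Prog.coin q
    if b then pure z else acceptReject g μ c n

/-- Truncated rejection sampling from the tilt of `μ` by `g`, with threshold `M`, failure
probability `δ`, an empirical normaliser, and `N = ⌈4 M log (4 / δ)⌉` trials. -/
def rejectionSampling {Z : Type} (g : Z → ℝ) (μ : PMF Z) (M δ : ℝ) : Prog Z := do
  let N := ⌈4 * M * Real.log (4 / δ)⌉₊
  let Zhat ← empiricalMean g μ N
  let c ← Prog.charge (M * Zhat)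
  acceptReject g μ c N

namespace ReasoningModel

variable {S : ℕ → Type} (m : ReasoningModel S) (s₀ : S 0) (Nm : ℕ) (M δRS : ℝ)

/-- The estimate of the normaliser `E_{s'_{t+1} ∼ π_ref(· | s₀, s_{1:t})} [V(s₀, (s_{1:t}, s'_{t+1}))]`
from `Nm` fresh samples. -/
def estNormalizer (t : ℕ) (s : Prefix S t) : Prog ℝ :=
  empiricalMean (fun x => m.V s₀ (t + 1) (s, x)) (m.ref s₀ t s) Nm

/-- The inner loop up to step `t`. The argument is the prefix of length `t` of the currently
accepted trajectory (`none` as long as there is none). It returns the proposed prefix `s`, its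
cumulative weight `w = ∏ V(s_{1:k}) / Ê_k(s_{1:k-1})`, and the cumulative weight `w'` of the
accepted prefix (which stays `1` as long as there is none). -/
def innerLoop : (t : ℕ) → Option (Prefix S t) → Prog (Prefix S t × ℝ × ℝ)
  | 0, _ => pure ((), 1, 1)
  | t + 1, acc => do
    let (s, w, w') ← innerLoop t (acc.map Prod.fst)
    let x ← rejectionSampling (fun y => m.V s₀ (t + 1) (s, y)) (m.ref s₀ t s) M δRS
    let v ← Prog.charge (m.V s₀ (t + 1) (s, x))
    let z ← m.estNormalizer s₀ Nm t s
    let f ← Prog.charge (v / z)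
    let wNew ← Prog.charge (w * f)
    match acc with
    | none => pure ((s, x), wNew, w')
    | some (a, y) => do
      let v' ← Prog.charge (m.V s₀ (t + 1) (a, y))
      let z' ← m.estNormalizer s₀ Nm t a
      let f' ← Prog.charge (v' / z')
      let wNew' ← Prog.charge (w' * f')
      pure ((s, x), wNew, wNew')

/-- The accepted trajectory after the iterations `h = 1, …, k + 1` of the outer loop: the first
proposal is accepted, and each later one passes a Metropolis-Hastings test with the estimated
ratio `(w' / V(acc)) * (V(s) / w)`. -/
def outerLoop (T : ℕ) : (k : ℕ) → Prog (Prefix S T)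
  | 0 => do
    let (s, _, _) ← m.innerLoop s₀ Nm M δRS T none
    pure s
  | k + 1 => do
    let acc ← outerLoop T k
    let (s, w, w') ← m.innerLoop s₀ Nm M δRS T (some acc)
    let vAcc ← Prog.charge (m.V s₀ T acc)
    let v ← Prog.charge (m.V s₀ T s)
    let q₁ ← Prog.charge (w' / vAcc)
    let q₂ ← Prog.charge (v / w)
    let q ← Prog.charge (q₁ * q₂)
    let b ← Prog.coin q
    if b then pure s else pure acc

/-- Rejection-based single-particle guided SMC with Metropolis-Hastings correction, with
`H ≥ 1` iterations of the outer loop. -/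
def spgSMCMH (T H : ℕ) : Prog (Prefix S T) := m.outerLoop s₀ Nm M δRS T (H - 1)

end ReasoningModel

end

/-! Let the exact proposal draw every `s_t` from the base model tilted by `V`. By the Bellman bound
the density of the target with respect to this proposal lies, up to a constant factor, between
`(1 + ε) ^ (-T)` and `(1 + ε) ^ T`. As `T * ε ≤ κ`, a Metropolis-Hastings step with exact weights
accepts with probability at least `β = exp (-2 * κ)` whatever the current and the proposed
trajectory. Its kernel therefore dominates `β` times the proposal, and by Doeblin's argument each
step contracts the total variation distance to the target by `1 - β`: a number of steps of order
`log (1 / δ_TV)` suffices.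

The algorithm departs from this chain in two ways, and the contraction makes the departures add up
to at most `1 / β` times the error of one step. Rejection sampling is within `δ'` of the exact tilt:
a Chernoff bound keeps the estimated normaliser within a constant factor, after which some trial is
accepted with high probability. The estimated weights change the acceptance probability by at most
their logarithmic error, to which each of the `T` factors contributes order `√(L / N_m)` in
expectation. With `N_m` of order `L * T ^ 2 / δ_TV ^ 2` and `δ'` small compared to `δ_TV / T`, the
law of the output is within `δ_TV` of the target without any conditioning. -/

/-! ### Expectations and total variation -/

/-- The expectation of a nonnegative function under a discrete distribution, as a sum, so that no
measurable structure is needed. -/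
noncomputable def expect {Ω : Type*} (μ : PMF Ω) (f : Ω → ℝ≥0∞) : ℝ≥0∞ := ∑' x, μ x * f x

section Expect

variable {Ω Ω' : Type*}

lemma expect_pure (a : Ω) (f : Ω → ℝ≥0∞) : expect (PMF.pure a) f = f a := by
  rw [expect, tsum_eq_single a]
  · simp
  · intro b hb
    simp [PMF.pure_apply, hb]

lemma expect_bind (μ : PMF Ω) (k : Ω → PMF Ω') (f : Ω' → ℝ≥0∞) :
    expect (μ.bind k) f = expect μ fun x => expect (k x) f := by
  simp only [expect, PMF.bind_apply, ← ENNReal.tsum_mul_right, ← ENNReal.tsum_mul_left]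
  rw [ENNReal.tsum_comm]
  simp only [mul_assoc]

lemma expect_map (μ : PMF Ω) (g : Ω → Ω') (f : Ω' → ℝ≥0∞) :
    expect (μ.map g) f = expect μ fun x => f (g x) := by
  rw [← PMF.bind_pure_comp, expect_bind]
  simp only [Function.comp, expect_pure]

lemma expect_mono (μ : PMF Ω) {f g : Ω → ℝ≥0∞} (h : ∀ x, f x ≤ g x) :
    expect μ f ≤ expect μ g :=
  ENNReal.tsum_le_tsum fun x => mul_le_mul_right (h x) _

lemma expect_const (μ : PMF Ω) (c : ℝ≥0∞) : expect μ (fun _ => c) = c := by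
  rw [expect, ENNReal.tsum_mul_right, PMF.tsum_coe, one_mul]

lemma expect_add (μ : PMF Ω) (f g : Ω → ℝ≥0∞) :
    expect μ (fun x => f x + g x) = expect μ f + expect μ g := by
  simp only [expect, mul_add, ENNReal.tsum_add]

lemma expect_const_mul (μ : PMF Ω) (c : ℝ≥0∞) (f : Ω → ℝ≥0∞) :
    expect μ (fun x => c * f x) = c * expect μ f := by
  simp only [expect, ← ENNReal.tsum_mul_left, mul_left_comm]

lemma expect_mul_const (μ : PMF Ω) (c : ℝ≥0∞) (f : Ω → ℝ≥0∞) :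
    expect μ (fun x => f x * c) = expect μ f * c := by
  simp only [expect, ← ENNReal.tsum_mul_right, mul_assoc]

lemma expect_le_of_forall_le (μ : PMF Ω) {f : Ω → ℝ≥0∞} {c : ℝ≥0∞} (h : ∀ x, f x ≤ c) :
    expect μ f ≤ c :=
  (expect_mono μ h).trans_eq (expect_const μ c)

lemma expect_add_expect_one_sub (μ : PMF Ω) {f : Ω → ℝ≥0∞} (h : ∀ x, f x ≤ 1) :
    expect μ f + expect μ (fun x => 1 - f x) = 1 := by
  simp only [← expect_add, add_tsub_cancel_of_le (h _), expect_const]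

lemma expect_comm (μ : PMF Ω) (ν : PMF Ω') (f : Ω → Ω' → ℝ≥0∞) :
    expect μ (fun x => expect ν (f x)) = expect ν (fun y => expect μ fun x => f x y) := by
  simp only [expect, ← ENNReal.tsum_mul_left]
  rw [ENNReal.tsum_comm]
  simp only [mul_left_comm]

lemma expect_indicator_one (μ : PMF Ω) (A : Set Ω) :
    expect μ (A.indicator 1) = μ.toOuterMeasure A := by
  rw [PMF.toOuterMeasure_apply, expect]
  refine tsum_congr fun x => ?_
  by_cases h : x ∈ A <;> simp [h]

lemma expect_indicator_singleton (μ : PMF Ω) (x : Ω) :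
    expect μ (({x} : Set Ω).indicator 1) = μ x := by
  rw [expect_indicator_one, PMF.toOuterMeasure_apply_singleton]

lemma eq_of_forall_expect_eq {μ ν : PMF Ω} (h : ∀ f : Ω → ℝ≥0∞, expect μ f = expect ν f) :
    μ = ν :=
  PMF.ext fun x => by rw [← expect_indicator_singleton μ, h, expect_indicator_singleton]

lemma expect_indicator_one_le_expect_exp (μ : PMF Ω) {A : Set Ω} {X : Ω → ℝ}
    (hX : ∀ x ∈ A, 0 ≤ X x) :
    expect μ (A.indicator 1) ≤ expect μ fun x => ENNReal.ofReal (Real.exp (X x)) :=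
  expect_mono μ <| Set.indicator_le fun x hx =>
    ENNReal.one_le_ofReal.2 (Real.one_le_exp (hX x hx))

/-- `μ` and `ν` are at total variation distance at most `c`, tested on functions with values in
`[0, 1]`; the reverse inequality follows by passing to `1 - f`. -/
def TVClose (c : ℝ≥0∞) (μ ν : PMF Ω) : Prop :=
  ∀ f : Ω → ℝ≥0∞, (∀ x, f x ≤ 1) → expect μ f ≤ expect ν f + c

namespace TVClose

variable {c d : ℝ≥0∞} {μ ν ρ : PMF Ω}

lemma refl (μ : PMF Ω) : TVClose 0 μ μ := fun _ _ => (add_zero _).ge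

lemma mono (h : TVClose c μ ν) (hcd : c ≤ d) : TVClose d μ ν :=
  fun f hf => (h f hf).trans (by gcongr)

lemma of_one_le (hc : 1 ≤ c) (μ ν : PMF Ω) : TVClose c μ ν := fun _ hf =>
  (expect_le_of_forall_le μ hf).trans (hc.trans le_add_self)

lemma trans (h : TVClose c μ ν) (h' : TVClose d ν ρ) : TVClose (c + d) μ ρ := fun f hf => by
  calc expect μ f ≤ expect ν f + c := h f hf
    _ ≤ expect ρ f + d + c := by gcongr; exact h' f hf
    _ = expect ρ f + (c + d) := by rw [add_assoc, add_comm d]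

lemma symm (h : TVClose c μ ν) : TVClose c ν μ := fun f hf => by
  have hcompl := h (fun x => 1 - f x) fun x => tsub_le_self
  have hfin : expect ν (fun x => 1 - f x) ≠ ∞ :=
    ne_top_of_le_ne_top ENNReal.one_ne_top (expect_le_of_forall_le ν fun x => tsub_le_self)
  refine (ENNReal.add_le_add_iff_right hfin).1 ?_
  calc expect ν f + expect ν (fun x => 1 - f x)
      = expect μ f + expect μ (fun x => 1 - f x) := by
        rw [expect_add_expect_one_sub ν hf, expect_add_expect_one_sub μ hf]
    _ ≤ expect μ f + (expect ν (fun x => 1 - f x) + c) := by gcongr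
    _ = expect μ f + c + expect ν (fun x => 1 - f x) := by rw [add_assoc, add_comm c]

lemma expect_le (h : TVClose c μ ν) {b : ℝ≥0∞} (hb : b ≠ ∞) {f : Ω → ℝ≥0∞}
    (hf : ∀ x, f x ≤ b) : expect μ f ≤ expect ν f + b * c := by
  rcases eq_or_ne b 0 with rfl | hb0
  · exact (expect_le_of_forall_le μ hf).trans zero_le
  have hscaled := h (fun x => b⁻¹ * f x) fun x =>
    (mul_le_mul_right (hf x) _).trans_eq (ENNReal.inv_mul_cancel hb0 hb)
  rw [expect_const_mul, expect_const_mul] at hscaled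
  calc expect μ f = b * (b⁻¹ * expect μ f) := (ENNReal.mul_inv_cancel_left hb0 hb).symm
    _ ≤ b * (b⁻¹ * expect ν f + c) := by gcongr
    _ = expect ν f + b * c := by rw [mul_add, ENNReal.mul_inv_cancel_left hb0 hb]

lemma bind_left (h : TVClose c μ ν) (k : Ω → PMF Ω') :
    TVClose c (μ.bind k) (ν.bind k) := fun f hf => by
  rw [expect_bind, expect_bind]
  exact h _ fun x => expect_le_of_forall_le _ hf

lemma bind_right (μ : PMF Ω) {k k' : Ω → PMF Ω'} {c : Ω → ℝ≥0∞}
    (h : ∀ x, TVClose (c x) (k x) (k' x)) :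
    TVClose (expect μ c) (μ.bind k) (μ.bind k') := fun f hf => by
  rw [expect_bind, expect_bind, ← expect_add]
  exact expect_mono _ fun x => h x f hf

lemma bind {k k' : Ω → PMF Ω'} (h : TVClose c μ ν) (h' : ∀ x, TVClose d (k x) (k' x)) :
    TVClose (c + d) (μ.bind k) (ν.bind k') :=
  (h.bind_left k).trans ((bind_right ν h').mono (expect_const ν d).le)

end TVClose

section Minorization

variable {β : ℝ≥0∞} {μ ν : PMF Ω}

lemma expect_eq_mul_expect_add_tsum_tsub (h : ∀ y, β * ν y ≤ μ y) (f : Ω → ℝ≥0∞) :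
    expect μ f = β * expect ν f + ∑' y, (μ y - β * ν y) * f y := by
  rw [expect, expect, ← ENNReal.tsum_mul_left, ← ENNReal.tsum_add]
  exact tsum_congr fun y => by rw [← mul_assoc, ← add_mul, add_tsub_cancel_of_le (h y)]

lemma tsum_tsub_mul_le_one_sub (h : ∀ y, β * ν y ≤ μ y) {f : Ω → ℝ≥0∞} (hf : ∀ y, f y ≤ 1) :
    ∑' y, (μ y - β * ν y) * f y ≤ 1 - β := by
  have hmass : β + ∑' y, (μ y - β * ν y) = 1 := by
    have := expect_eq_mul_expect_add_tsum_tsub h fun _ => 1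
    simpa only [expect_const, mul_one, eq_comm] using this
  calc ∑' y, (μ y - β * ν y) * f y ≤ ∑' y, (μ y - β * ν y) :=
        ENNReal.tsum_le_tsum fun y => mul_le_of_le_one_right' (hf y)
    _ = 1 - β := ENNReal.eq_sub_of_add_eq' ENNReal.one_ne_top (by rwa [add_comm])

/-- Doeblin contraction: the part `β • ν` of the kernel forgets its starting point. -/
theorem TVClose.contract {c : ℝ≥0∞} {μ μ' : PMF Ω} {k : Ω → PMF Ω'} {ν : PMF Ω'}
    (hk : ∀ x y, β * ν y ≤ k x y) (h : TVClose c μ μ') :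
    TVClose ((1 - β) * c) (μ.bind k) (μ'.bind k) := fun f hf => by
  simp only [expect_bind, expect_eq_mul_expect_add_tsum_tsub (hk _) f, expect_add, expect_const,
    add_assoc]
  gcongr
  exact h.expect_le (ne_top_of_le_ne_top ENNReal.one_ne_top tsub_le_self)
    fun x => tsum_tsub_mul_le_one_sub (hk x) hf

end Minorization

end Expect

section TotalVariation

variable {Ω : Type} {μ ν : PMF Ω}

lemma prob_univ (μ : PMF Ω) : prob μ Set.univ = 1 := by
  rw [prob, (PMF.toOuterMeasure_apply_eq_one_iff _ _).2 (Set.subset_univ _), ENNReal.toReal_one]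

lemma TVClose.prob_le {c : ℝ} (h : TVClose (ENNReal.ofReal c) μ ν) (hc : 0 ≤ c) (A : Set Ω) :
    prob μ A ≤ prob ν A + c := by
  have hle (x : Ω) : A.indicator (1 : Ω → ℝ≥0∞) x ≤ 1 :=
    Set.indicator_le_self' (fun _ _ => zero_le) x
  have hA := h (A.indicator 1) hle
  have hfin := ne_top_of_le_ne_top ENNReal.one_ne_top (expect_le_of_forall_le ν hle)
  rw [expect_indicator_one, expect_indicator_one] at hA
  rw [expect_indicator_one] at hfin
  have hreal := ENNReal.toReal_mono (by finiteness) hA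
  rwa [ENNReal.toReal_add hfin ENNReal.ofReal_ne_top, ENNReal.toReal_ofReal hc] at hreal

lemma TVClose.tvDist_le {c : ℝ} (h : TVClose (ENNReal.ofReal c) μ ν) (hc : 0 ≤ c) :
    tvDist μ ν ≤ c :=
  ciSup_le fun A => abs_sub_le_iff.2
    ⟨sub_le_iff_le_add'.2 (h.prob_le hc A), sub_le_iff_le_add'.2 (h.symm.prob_le hc A)⟩

end TotalVariation

/-! ### Output laws and running times of programs -/

namespace Prog

variable {α β : Type}

/-- The law of the output of a program. -/
noncomputable def outputLaw (p : Prog α) : PMF α := p.law.map p.output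

lemma outputLaw_ret (a : α) : (ret a).outputLaw = PMF.pure a := PMF.pure_map _ _

lemma outputLaw_pure (a : α) : (pure a : Prog α).outputLaw = PMF.pure a := outputLaw_ret a

lemma outputLaw_charge (a : α) : (charge a).outputLaw = PMF.pure a := outputLaw_ret a

lemma outputLaw_draw {Z : Type} (μ : PMF Z) (next : Z → Prog α) :
    (draw μ next).outputLaw = μ.bind fun z => (next z).outputLaw := by
  change (μ.bind fun z => (next z).law.map fun r => (⟨z, r⟩ : (z : Z) × (next z).Run)).map
    (fun r : (z : Z) × (next z).Run => (next r.1).output r.2) = _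
  rw [PMF.map_bind]
  simp only [PMF.map_comp]
  rfl

lemma outputLaw_sample {Z : Type} (μ : PMF Z) : (sample μ).outputLaw = μ := by
  rw [sample, outputLaw_draw]
  simp only [outputLaw_ret, PMF.bind_pure]

lemma outputLaw_coin (r : ℝ) : (coin r).outputLaw = bernoulli r := outputLaw_sample _

lemma outputLaw_bind (p : Prog α) (f : α → Prog β) :
    (p >>= f).outputLaw = p.outputLaw.bind fun a => (f a).outputLaw := by
  change (p.bind f).outputLaw = _
  induction p with
  | ret a => rw [Prog.bind, outputLaw_ret, PMF.pure_bind]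
  | draw μ next ih =>
    rw [Prog.bind, outputLaw_draw, outputLaw_draw, PMF.bind_bind]
    exact congrArg _ (funext ih)
  | tick _ ih => exact ih

lemma outputGiven_univ (p : Prog α) (hE : ∃ r ∈ Set.univ, r ∈ p.law.support) :
    p.outputGiven Set.univ hE = p.outputLaw := by
  have hfilter : p.law.filter Set.univ hE = p.law := by
    ext r
    simp [PMF.filter_apply, PMF.tsum_coe]
  rw [outputGiven, hfilter, outputLaw]

lemma exists_tvDist_outputGiven_le (p : Prog α) {π : PMF α} {δ c : ℝ} (hδ : 0 ≤ δ)
    (h : tvDist π p.outputLaw ≤ c) :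
    ∃ (E : Set p.Run) (hE : ∃ r ∈ E, r ∈ p.law.support),
      1 - δ ≤ prob p.law E ∧ tvDist π (p.outputGiven E hE) ≤ c := by
  obtain ⟨r, hr⟩ := p.law.support_nonempty
  refine ⟨Set.univ, ⟨r, Set.mem_univ r, hr⟩, ?_, ?_⟩
  · rw [prob_univ]
    exact sub_le_self 1 hδ
  · rwa [outputGiven_univ]

/-- Every execution of `p` takes time at most `n`. -/
def TimeLE (p : Prog α) (n : ℕ) : Prop := ∀ r : p.Run, p.time r ≤ n

lemma exists_time_bind_eq_add (p : Prog α) (f : α → Prog β) (r : (p.bind f).Run) :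
    ∃ (r₁ : p.Run) (a : α) (r₂ : (f a).Run), (p.bind f).time r = p.time r₁ + (f a).time r₂ := by
  induction p with
  | ret a => exact ⟨(), a, r, (Nat.zero_add _).symm⟩
  | draw μ next ih =>
    obtain ⟨r₁, a, r₂, h⟩ := ih r.1 r.2
    refine ⟨⟨r.1, r₁⟩, a, r₂, ?_⟩
    change ((next r.1).bind f).time r.2 + 1 = (next r.1).time r₁ + 1 + (f a).time r₂
    omega
  | tick next ih =>
    obtain ⟨r₁, a, r₂, h⟩ := ih r
    refine ⟨r₁, a, r₂, ?_⟩
    change (next.bind f).time r + 1 = next.time r₁ + 1 + (f a).time r₂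
    omega

lemma TimeLE.bind {p : Prog α} {f : α → Prog β} {m n : ℕ} (hp : p.TimeLE m)
    (hf : ∀ a, (f a).TimeLE n) : (p >>= f).TimeLE (m + n) := fun r => by
  obtain ⟨r₁, a, r₂, h⟩ := exists_time_bind_eq_add p f r
  exact h.trans_le (Nat.add_le_add (hp r₁) (hf a r₂))

lemma TimeLE.mono {p : Prog α} {m n : ℕ} (hp : p.TimeLE m) (h : m ≤ n) : p.TimeLE n :=
  fun r => (hp r).trans h

lemma timeLE_pure (a : α) (n : ℕ) : (pure a : Prog α).TimeLE n := fun _ => Nat.zero_le n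

lemma timeLE_charge (a : α) : (charge a).TimeLE 1 := fun _ => le_rfl

lemma timeLE_sample {Z : Type} (μ : PMF Z) : (sample μ).TimeLE 1 := fun _ => le_rfl

lemma timeLE_coin (r : ℝ) : (coin r).TimeLE 1 := timeLE_sample _

end Prog

section Time

open Prog

variable {Z : Type} (g : Z → ℝ) (μ : PMF Z)

lemma timeLE_sumScores (n : ℕ) : (sumScores g μ n).TimeLE (3 * n) := by
  induction n with
  | zero => exact timeLE_pure _ _
  | succ n ih =>
    have h : (sumScores g μ (n + 1)).TimeLE (1 + (1 + (3 * n + 1))) :=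
      (timeLE_sample μ).bind fun _ => (timeLE_charge _).bind fun _ =>
        ih.bind fun _ => timeLE_charge _
    exact h.mono (by omega)

lemma timeLE_empiricalMean (n : ℕ) : (empiricalMean g μ n).TimeLE (3 * n + 1) :=
  (timeLE_sumScores g μ n).bind fun _ => timeLE_charge _

lemma timeLE_acceptReject (c : ℝ) (n : ℕ) : (acceptReject g μ c n).TimeLE (4 * n + 1) := by
  induction n with
  | zero => exact timeLE_sample _
  | succ n ih =>
    have h : (acceptReject g μ c (n + 1)).TimeLE (1 + (1 + (1 + (1 + (4 * n + 1))))) := by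
      refine (timeLE_sample μ).bind fun _ => (timeLE_charge _).bind fun _ =>
        (timeLE_charge _).bind fun _ => (timeLE_coin _).bind fun b => ?_
      cases b
      · exact ih
      · exact timeLE_pure _ _
    exact h.mono (by omega)

lemma timeLE_rejectionSampling (M δ : ℝ) :
    (rejectionSampling g μ M δ).TimeLE (7 * ⌈4 * M * Real.log (4 / δ)⌉₊ + 3) :=
  ((timeLE_empiricalMean g μ _).bind fun _ => (timeLE_charge _).bind fun _ =>
    timeLE_acceptReject g μ _ _).mono (by omega)

namespace ReasoningModel

variable {S : ℕ → Type} (m : ReasoningModel S) (s₀ : S 0) (Nm : ℕ) (M δRS : ℝ)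

lemma timeLE_innerLoop (t : ℕ) (acc : Option (Prefix S t)) :
    (m.innerLoop s₀ Nm M δRS t acc).TimeLE
      (t * (7 * ⌈4 * M * Real.log (4 / δRS)⌉₊ + 6 * Nm + 12)) := by
  induction t with
  | zero => exact timeLE_pure _ _
  | succ t ih =>
    refine TimeLE.mono ((ih _).bind fun _ => (timeLE_rejectionSampling _ _ M δRS).bind fun _ =>
      (timeLE_charge _).bind fun _ => (timeLE_empiricalMean _ _ Nm).bind fun _ =>
      (timeLE_charge _).bind fun _ => (timeLE_charge _).bind
        (n := 1 + (3 * Nm + 1 + (1 + (1 + 0)))) fun _ => ?_) (by lia)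
    rcases acc with _ | ⟨a, y⟩
    · exact timeLE_pure _ _
    · exact (timeLE_charge _).bind fun _ => (timeLE_empiricalMean _ _ Nm).bind fun _ =>
        (timeLE_charge _).bind fun _ => (timeLE_charge _).bind fun _ => timeLE_pure _ _

lemma timeLE_outerLoop (T k : ℕ) :
    (m.outerLoop s₀ Nm M δRS T k).TimeLE
      ((k + 1) * (T * (7 * ⌈4 * M * Real.log (4 / δRS)⌉₊ + 6 * Nm + 12) + 6)) := by
  induction k with
  | zero =>
    exact ((m.timeLE_innerLoop s₀ Nm M δRS T none).bind fun _ => timeLE_pure _ 0).mono (by omega)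
  | succ k ih =>
    refine TimeLE.mono (ih.bind fun _ => (m.timeLE_innerLoop s₀ Nm M δRS T _).bind fun _ =>
      (timeLE_charge _).bind fun _ => (timeLE_charge _).bind fun _ =>
      (timeLE_charge _).bind fun _ => (timeLE_charge _).bind fun _ =>
      (timeLE_charge _).bind fun _ => (timeLE_coin _).bind (n := 0) fun b => ?_) (by lia)
    cases b <;> exact timeLE_pure _ _

end ReasoningModel

end Time

/-! ### Empirical means of bounded scores -/

lemma ofReal_exp_mul_ofReal_exp (x y : ℝ) :
    ENNReal.ofReal (Real.exp x) * ENNReal.ofReal (Real.exp y) =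
      ENNReal.ofReal (Real.exp (x + y)) := by
  rw [← ENNReal.ofReal_mul (Real.exp_pos x).le, Real.exp_add]

lemma abs_le_inv_mul_exp_add_exp_neg {τ : ℝ} (hτ : 0 < τ) (y : ℝ) :
    |y| ≤ τ⁻¹ * (Real.exp (τ * y) + Real.exp (-τ * y)) := by
  have habs : |τ * y| ≤ Real.exp (τ * y) + Real.exp (-τ * y) := by
    rw [neg_mul]
    linarith [Real.add_one_le_exp |τ * y|, Real.exp_abs_le (τ * y)]
  rwa [le_inv_mul_iff₀ hτ, ← abs_of_pos hτ, ← abs_mul, abs_of_pos hτ]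

lemma outputLaw_empiricalMean {Z : Type} (g : Z → ℝ) (μ : PMF Z) (n : ℕ) :
    (empiricalMean g μ n).outputLaw = (sumScores g μ n).outputLaw.map fun a : ℝ => a / n := by
  simp only [empiricalMean, Prog.outputLaw_bind, Prog.outputLaw_charge]
  exact PMF.bind_pure_comp _ _

/-- The scores `g` are nonnegative with expectation `v > 0` under `μ`, and bounded by `B * v`. -/
structure ScoreBound {Z : Type} (g : Z → ℝ) (μ : PMF Z) (v B : ℝ) : Prop where
  v_pos : 0 < v
  nonneg : ∀ z, 0 ≤ g z
  le : ∀ z, g z ≤ B * v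
  mean : expect μ (fun z => ENNReal.ofReal (g z)) = ENNReal.ofReal v

namespace ScoreBound

variable {Z : Type} {g : Z → ℝ} {μ : PMF Z} {v B : ℝ}

lemma mean_le_of_forall_le (h : ScoreBound g μ v B) {c : ℝ} (hc : ∀ z, g z ≤ c) : v ≤ c := by
  have hle : ENNReal.ofReal v ≤ ENNReal.ofReal c := by
    rw [← h.mean]
    exact expect_le_of_forall_le μ fun z => ENNReal.ofReal_le_ofReal (hc z)
  exact (ENNReal.ofReal_le_ofReal_iff'.1 hle).resolve_right h.v_pos.not_ge

lemma one_le (h : ScoreBound g μ v B) : 1 ≤ B :=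
  le_of_mul_le_mul_right ((one_mul v).trans_le (h.mean_le_of_forall_le h.le)) h.v_pos

lemma bound_pos (h : ScoreBound g μ v B) : 0 < B := one_pos.trans_le h.one_le

lemma expect_ofReal_one_add_mul (h : ScoreBound g μ v B) {b : ℝ}
    (hb : ∀ z, 0 ≤ 1 + b * g z) :
    expect μ (fun z => ENNReal.ofReal (1 + b * g z)) = ENNReal.ofReal (1 + b * v) := by
  have hmean : HasSum (fun z => (μ z).toReal * g z) v := by
    have hfin : ∑' z, μ z * ENNReal.ofReal (g z) ≠ ∞ := h.mean.trans_ne ENNReal.ofReal_ne_top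
    have hsum := ENNReal.hasSum_toReal hfin
    rw [← ENNReal.tsum_toReal_eq (ENNReal.ne_top_of_tsum_ne_top hfin)] at hsum
    change HasSum _ (expect μ fun z => ENNReal.ofReal (g z)).toReal at hsum
    simpa only [h.mean, ENNReal.toReal_mul, ENNReal.toReal_ofReal (h.nonneg _),
      ENNReal.toReal_ofReal h.v_pos.le] using hsum
  have hmass : HasSum (fun z => (μ z).toReal) 1 := by
    have hsum := ENNReal.hasSum_toReal μ.tsum_coe_ne_top
    rwa [← ENNReal.tsum_toReal_eq μ.apply_ne_top, μ.tsum_coe, ENNReal.toReal_one] at hsum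
  have haffine : HasSum (fun z => (μ z).toReal * (1 + b * g z)) (1 + b * v) := by
    convert hmass.add (hmean.mul_left b) using 2
    ring
  rw [← haffine.tsum_eq, ENNReal.ofReal_tsum_of_nonneg
    (fun z => mul_nonneg ENNReal.toReal_nonneg (hb z)) haffine.summable, expect]
  simp only [ENNReal.ofReal_mul ENNReal.toReal_nonneg, ENNReal.ofReal_toReal (μ.apply_ne_top _)]

lemma expect_exp_le (h : ScoreBound g μ v B) {θ : ℝ} (hθ : |θ| * B ≤ 1) :
    expect μ (fun z => ENNReal.ofReal (Real.exp (θ * (g z / v)))) ≤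
      ENNReal.ofReal (Real.exp (θ + θ ^ 2 * B)) := by
  -- `exp x ≤ 1 + x + x ^ 2` for `|x| ≤ 1`, and `(g / v) ^ 2 ≤ B * (g / v)`.
  have hpointwise (z : Z) :
      Real.exp (θ * (g z / v)) ≤ 1 + (θ + θ ^ 2 * B) / v * g z := by
    have hnonneg : 0 ≤ g z / v := div_nonneg (h.nonneg z) h.v_pos.le
    have hle : g z / v ≤ B := (div_le_iff₀ h.v_pos).2 (h.le z)
    have hsmall : |θ * (g z / v)| ≤ 1 := by
      rw [abs_mul, abs_of_nonneg hnonneg]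
      exact (mul_le_mul_of_nonneg_left hle (abs_nonneg θ)).trans hθ
    have hquad := (abs_le.1 (Real.abs_exp_sub_one_sub_id_le hsmall)).2
    calc Real.exp (θ * (g z / v)) ≤ 1 + θ * (g z / v) + θ ^ 2 * (g z / v * (g z / v)) := by
          linarith
      _ ≤ 1 + θ * (g z / v) + θ ^ 2 * (B * (g z / v)) := by gcongr
      _ = 1 + (θ + θ ^ 2 * B) / v * g z := by ring
  calc expect μ (fun z => ENNReal.ofReal (Real.exp (θ * (g z / v))))
      ≤ expect μ (fun z => ENNReal.ofReal (1 + (θ + θ ^ 2 * B) / v * g z)) :=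
        expect_mono μ fun z => ENNReal.ofReal_le_ofReal (hpointwise z)
    _ = ENNReal.ofReal (1 + (θ + θ ^ 2 * B)) := by
        rw [h.expect_ofReal_one_add_mul fun z => (Real.exp_pos _).le.trans (hpointwise z),
          div_mul_cancel₀ _ h.v_pos.ne']
    _ ≤ ENNReal.ofReal (Real.exp (θ + θ ^ 2 * B)) :=
        ENNReal.ofReal_le_ofReal ((add_comm _ _).trans_le (Real.add_one_le_exp _))

lemma expect_exp_sumScores_le (h : ScoreBound g μ v B) {θ : ℝ} (hθ : |θ| * B ≤ 1) (n : ℕ) :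
    expect (sumScores g μ n).outputLaw (fun a => ENNReal.ofReal (Real.exp (θ * (a / v)))) ≤
      ENNReal.ofReal (Real.exp (n * (θ + θ ^ 2 * B))) := by
  induction n with
  | zero => simp [sumScores, Prog.outputLaw_pure, expect_pure]
  | succ n ih =>
    have hindep : expect (sumScores g μ (n + 1)).outputLaw
        (fun a => ENNReal.ofReal (Real.exp (θ * (a / v)))) =
        expect μ (fun z => ENNReal.ofReal (Real.exp (θ * (g z / v)))) *
        expect (sumScores g μ n).outputLaw
          (fun a => ENNReal.ofReal (Real.exp (θ * (a / v)))) := by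
      rw [← expect_mul_const]
      simp only [sumScores, Prog.outputLaw_bind, Prog.outputLaw_sample, Prog.outputLaw_charge,
        PMF.pure_bind, expect_bind, expect_pure, ← expect_const_mul, ofReal_exp_mul_ofReal_exp,
        add_div, mul_add, add_comm]
    rw [hindep]
    refine (mul_le_mul' (h.expect_exp_le hθ) ih).trans_eq ?_
    rw [ofReal_exp_mul_ofReal_exp, Nat.cast_succ, add_one_mul, add_comm]

lemma expect_exp_empiricalMean_le (h : ScoreBound g μ v B) {n : ℕ} (hn : 0 < n) {τ : ℝ}
    (hτ : |τ| * B ≤ n) (s : ℝ) :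
    expect (empiricalMean g μ n).outputLaw
      (fun a => ENNReal.ofReal (Real.exp (τ * (a / v - s)))) ≤
      ENNReal.ofReal (Real.exp (τ * (1 - s) + τ ^ 2 * B / n)) := by
  have hn' : (0 : ℝ) < n := Nat.cast_pos.2 hn
  have hθ : |τ / n| * B ≤ 1 := by
    rwa [abs_div, Nat.abs_cast, div_mul_eq_mul_div, div_le_one hn']
  have hsplit (a : ℝ) : τ * (a / n / v - s) = τ / n * (a / v) + -(τ * s) := by
    field_simp
    ring
  have hexponent : n * (τ / n + (τ / n) ^ 2 * B) + -(τ * s) = τ * (1 - s) + τ ^ 2 * B / n := by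
    field_simp
    ring
  rw [← hexponent]
  simp only [outputLaw_empiricalMean, expect_map, hsplit, ← ofReal_exp_mul_ofReal_exp,
    expect_mul_const]
  gcongr
  exact h.expect_exp_sumScores_le hθ n

theorem expect_abs_empiricalMean_le (h : ScoreBound g μ v B) {n : ℕ} (hn : B ≤ n) :
    expect (empiricalMean g μ n).outputLaw (fun a => ENNReal.ofReal |a / v - 1|) ≤
      ENNReal.ofReal (6 * √(B / n)) := by
  have hB := h.bound_pos
  have hn' : (0 : ℝ) < n := hB.trans_le hn
  -- This choice makes the exponent `τ ^ 2 * B / n` of the moment generating function equal to `1`.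
  set τ := √(n / B) with hτ_def
  have hτ : 0 < τ := Real.sqrt_pos.2 (div_pos hn' hB)
  have hτ_sq : τ ^ 2 * B = n := by
    rw [hτ_def, Real.sq_sqrt (by positivity), div_mul_cancel₀ _ hB.ne']
  have hτ_le : τ * B ≤ n := by
    have hτ_one : 1 ≤ τ := Real.one_le_sqrt.2 ((one_le_div hB).2 hn)
    rw [← hτ_sq]
    gcongr
    exact le_self_pow₀ hτ_one two_ne_zero
  have hmgf {σ : ℝ} (hσ : |σ| = τ) : expect (empiricalMean g μ n).outputLaw
      (fun a => ENNReal.ofReal (Real.exp (σ * (a / v - 1)))) ≤ ENNReal.ofReal (Real.exp 1) := by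
    refine (h.expect_exp_empiricalMean_le (Nat.cast_pos.1 hn') (hσ ▸ hτ_le) 1).trans_eq ?_
    rw [← sq_abs, hσ, hτ_sq, div_self hn'.ne', sub_self, mul_zero, zero_add]
  calc expect (empiricalMean g μ n).outputLaw (fun a => ENNReal.ofReal |a / v - 1|)
      ≤ expect (empiricalMean g μ n).outputLaw (fun a => ENNReal.ofReal τ⁻¹ *
          (ENNReal.ofReal (Real.exp (τ * (a / v - 1))) +
            ENNReal.ofReal (Real.exp (-τ * (a / v - 1))))) := expect_mono _ fun a => by
        rw [← ENNReal.ofReal_add (Real.exp_pos _).le (Real.exp_pos _).le,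
          ← ENNReal.ofReal_mul (by positivity)]
        exact ENNReal.ofReal_le_ofReal (abs_le_inv_mul_exp_add_exp_neg hτ _)
    _ ≤ ENNReal.ofReal τ⁻¹ * (ENNReal.ofReal (Real.exp 1) + ENNReal.ofReal (Real.exp 1)) := by
        rw [expect_const_mul, expect_add]
        gcongr
        · exact hmgf (abs_of_pos hτ)
        · exact hmgf (by rw [abs_neg, abs_of_pos hτ])
    _ = ENNReal.ofReal (2 * Real.exp 1 * √(B / n)) := by
        rw [← ENNReal.ofReal_add (Real.exp_pos _).le (Real.exp_pos _).le,
          ← ENNReal.ofReal_mul (by positivity), ← two_mul, mul_comm, ← Real.sqrt_inv, inv_div]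
    _ ≤ ENNReal.ofReal (6 * √(B / n)) := by
        gcongr
        linarith [Real.exp_one_lt_d9]

lemma expect_empiricalMean_gt_le (h : ScoreBound g μ v B) {n : ℕ} (hn : 0 < n) :
    expect (empiricalMean g μ n).outputLaw ({a | 4 * v < a}.indicator 1) ≤
      ENNReal.ofReal (Real.exp (-(n / (8 * B)))) := by
  have hB := h.bound_pos
  have hτ : |n / B| * B ≤ n := by rw [abs_of_nonneg (by positivity), div_mul_cancel₀ _ hB.ne']
  refine (expect_indicator_one_le_expect_exp _ fun a ha => ?_).trans
    ((h.expect_exp_empiricalMean_le hn hτ 4).trans ?_)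
  · exact mul_nonneg (by positivity) (sub_nonneg.2 ((le_div_iff₀ h.v_pos).2 (le_of_lt ha)))
  · gcongr
    have hexponent : n / B * (1 - 4) + (n / B) ^ 2 * B / n = -(n / (8 * B)) * 16 := by
      field_simp
      ring
    have : 0 ≤ n / (8 * B) := by positivity
    linarith

lemma expect_empiricalMean_lt_le (h : ScoreBound g μ v B) {n : ℕ} (hn : 0 < n) :
    expect (empiricalMean g μ n).outputLaw ({a | a < v / 4}.indicator 1) ≤
      ENNReal.ofReal (Real.exp (-(n / (8 * B)))) := by
  have hB := h.bound_pos
  have hτ : |-(n / (2 * B))| * B ≤ n := by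
    rw [abs_neg, abs_of_nonneg (by positivity)]
    field_simp
    norm_num
  refine (expect_indicator_one_le_expect_exp _ fun a ha => ?_).trans
    ((h.expect_exp_empiricalMean_le hn hτ (1 / 4)).trans_eq ?_)
  · have hlt : a / v ≤ 1 / 4 := (div_le_iff₀ h.v_pos).2 (by linarith [ha.out])
    exact mul_nonneg_of_nonpos_of_nonpos (neg_nonpos.2 (by positivity)) (sub_nonpos.2 hlt)
  · congr 2
    field_simp
    ring

end ScoreBound

/-! ### Rejection sampling -/

lemma expect_bernoulli (r : ℝ) (f : Bool → ℝ≥0∞) :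
    expect (Prog.bernoulli r) f =
      min (ENNReal.ofReal r) 1 * f true + (1 - min (ENNReal.ofReal r) 1) * f false := by
  simp [expect, Prog.bernoulli, PMF.ofFintype_apply]

/-- The tilt of `μ` by `g`, with mass proportional to `μ z * g z`; its value is `μ` when the
normalising constant is `0` or infinite. -/
noncomputable def tilt {Z : Type*} (g : Z → ℝ) (μ : PMF Z) : PMF Z :=
  open Classical in
  if h : (∑' z, μ z * ENNReal.ofReal (g z) ≠ 0) ∧ (∑' z, μ z * ENNReal.ofReal (g z) ≠ ∞) then
    PMF.normalize (fun z => μ z * ENNReal.ofReal (g z)) h.1 h.2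
  else μ

namespace ScoreBound

variable {Z : Type} {g : Z → ℝ} {μ : PMF Z} {v B : ℝ}

lemma tilt_apply (h : ScoreBound g μ v B) (z : Z) :
    tilt g μ z = (ENNReal.ofReal v)⁻¹ * (μ z * ENNReal.ofReal (g z)) := by
  have hsum : ∑' z, μ z * ENNReal.ofReal (g z) = ENNReal.ofReal v := h.mean
  have hnormalizable : (∑' z, μ z * ENNReal.ofReal (g z) ≠ 0) ∧
      (∑' z, μ z * ENNReal.ofReal (g z) ≠ ∞) := by
    rw [hsum]
    exact ⟨(ENNReal.ofReal_pos.2 h.v_pos).ne', ENNReal.ofReal_ne_top⟩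
  rw [tilt, dif_pos hnormalizable, PMF.normalize_apply, hsum, mul_comm]

lemma expect_score_mul (h : ScoreBound g μ v B) (f : Z → ℝ≥0∞) :
    expect μ (fun z => ENNReal.ofReal (g z) * f z) = ENNReal.ofReal v * expect (tilt g μ) f := by
  simp only [expect, ← ENNReal.tsum_mul_left, h.tilt_apply, ← mul_assoc,
    ENNReal.mul_inv_cancel (ENNReal.ofReal_pos.2 h.v_pos).ne' ENNReal.ofReal_ne_top, one_mul]

lemma expect_acceptReject_succ (h : ScoreBound g μ v B) {c : ℝ} (hc : ∀ z, g z ≤ c) (n : ℕ)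
    (f : Z → ℝ≥0∞) :
    expect (acceptReject g μ c (n + 1)).outputLaw f =
      ENNReal.ofReal (v / c) * expect (tilt g μ) f +
        (1 - ENNReal.ofReal (v / c)) * expect (acceptReject g μ c n).outputLaw f := by
  have hc0 : 0 < c := h.v_pos.trans_le (h.mean_le_of_forall_le hc)
  have hscale (x : ℝ) : ENNReal.ofReal (x / c) = ENNReal.ofReal c⁻¹ * ENNReal.ofReal x := by
    rw [← ENNReal.ofReal_mul (inv_nonneg.2 hc0.le), inv_mul_eq_div]
  have hle (z : Z) : ENNReal.ofReal (g z / c) ≤ 1 :=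
    ENNReal.ofReal_le_one.2 ((div_le_one hc0).2 (hc z))
  have haccept : expect μ (fun z => ENNReal.ofReal (g z / c) * f z) =
      ENNReal.ofReal (v / c) * expect (tilt g μ) f := by
    simp only [hscale, mul_assoc, expect_const_mul, h.expect_score_mul]
  have hreject : expect μ (fun z => 1 - ENNReal.ofReal (g z / c)) =
      1 - ENNReal.ofReal (v / c) := by
    have hmean : expect μ (fun z => ENNReal.ofReal (g z / c)) = ENNReal.ofReal (v / c) := by
      simp only [hscale, expect_const_mul, h.mean]
    refine ENNReal.eq_sub_of_add_eq ENNReal.ofReal_ne_top ?_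
    rw [← hmean, add_comm, expect_add_expect_one_sub μ hle]
  calc expect (acceptReject g μ c (n + 1)).outputLaw f
      = expect μ fun z => ENNReal.ofReal (g z / c) * f z +
          (1 - ENNReal.ofReal (g z / c)) * expect (acceptReject g μ c n).outputLaw f := by
        simp only [acceptReject, Prog.outputLaw_bind, Prog.outputLaw_sample,
          Prog.outputLaw_charge, PMF.pure_bind, Prog.outputLaw_coin, expect_bind,
          expect_bernoulli, min_eq_left (hle _), if_true, Prog.outputLaw_pure, expect_pure,
          Bool.false_eq_true, if_false]
    _ = ENNReal.ofReal (v / c) * expect (tilt g μ) f +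
          (1 - ENNReal.ofReal (v / c)) * expect (acceptReject g μ c n).outputLaw f := by
        rw [expect_add, expect_mul_const, haccept, hreject]

lemma tvClose_acceptReject (h : ScoreBound g μ v B) {c : ℝ} (hc : ∀ z, g z ≤ c) (n : ℕ) :
    TVClose ((1 - ENNReal.ofReal (v / c)) ^ n) (acceptReject g μ c n).outputLaw (tilt g μ) := by
  have hvc : v ≤ c := h.mean_le_of_forall_le hc
  have hp : ENNReal.ofReal (v / c) ≤ 1 :=
    ENNReal.ofReal_le_one.2 (div_le_one_of_le₀ hvc (h.v_pos.le.trans hvc))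
  induction n with
  | zero => exact TVClose.of_one_le (pow_zero _).ge _ _
  | succ n ih =>
    intro f hf
    rw [h.expect_acceptReject_succ hc]
    set p := ENNReal.ofReal (v / c)
    calc p * expect (tilt g μ) f + (1 - p) * expect (acceptReject g μ c n).outputLaw f
        ≤ p * expect (tilt g μ) f + (1 - p) * (expect (tilt g μ) f + (1 - p) ^ n) := by
          gcongr
          exact ih f hf
      _ = (p + (1 - p)) * expect (tilt g μ) f + (1 - p) ^ (n + 1) := by ring
      _ = expect (tilt g μ) f + (1 - p) ^ (n + 1) := by rw [add_tsub_cancel_of_le hp, one_mul]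

lemma tvClose_acceptReject_of_estimate (h : ScoreBound g μ v B) {M a : ℝ} (hM : 4 * B ≤ M)
    (ha : v / 4 ≤ a) (ha' : a ≤ 4 * v) (n : ℕ) :
    TVClose (ENNReal.ofReal (Real.exp (-(n / (4 * M))))) (acceptReject g μ (M * a) n).outputLaw
      (tilt g μ) := by
  have hv := h.v_pos
  have hB := h.bound_pos
  have hM0 : 0 < M := by linarith
  have ha0 : 0 < a := by linarith
  have hle (z : Z) : g z ≤ M * a := by
    calc g z ≤ B * v := h.le z
      _ = 4 * B * (v / 4) := by ring
      _ ≤ M * a := by gcongr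
  have hp : 1 / (4 * M) ≤ v / (M * a) := by
    rw [div_le_div_iff₀ (by positivity) (by positivity)]
    nlinarith
  have hreject : 1 - ENNReal.ofReal (v / (M * a)) ≤ ENNReal.ofReal (Real.exp (-(1 / (4 * M)))) := by
    rw [← ENNReal.ofReal_one, ← ENNReal.ofReal_sub _ (by positivity)]
    exact ENNReal.ofReal_le_ofReal (by linarith [Real.add_one_le_exp (-(1 / (4 * M)))])
  refine (h.tvClose_acceptReject hle n).mono ((pow_le_pow_left' hreject n).trans_eq ?_)
  rw [← ENNReal.ofReal_pow (Real.exp_pos _).le, ← Real.exp_nat_mul, mul_neg, mul_one_div]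

lemma tvClose_acceptReject_estimate (h : ScoreBound g μ v B) {M : ℝ} (hM : 4 * B ≤ M) (a : ℝ)
    (n : ℕ) :
    TVClose (({a | 4 * v < a} : Set ℝ).indicator 1 a +
      (({a | a < v / 4} : Set ℝ).indicator 1 a +
        ENNReal.ofReal (Real.exp (-(n / (4 * M))))))
      (acceptReject g μ (M * a) n).outputLaw (tilt g μ) := by
  by_cases hgt : 4 * v < a
  · refine TVClose.of_one_le ?_ _ _
    rw [Set.indicator_of_mem (show a ∈ {a | 4 * v < a} from hgt)]
    exact le_self_add
  by_cases hlt : a < v / 4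
  · refine TVClose.of_one_le ?_ _ _
    rw [Set.indicator_of_mem (show a ∈ {a | a < v / 4} from hlt)]
    exact le_self_add.trans le_add_self
  · exact (h.tvClose_acceptReject_of_estimate hM (not_lt.1 hlt) (not_lt.1 hgt) n).mono
      (le_add_self.trans le_add_self)

theorem tvClose_rejectionSampling (h : ScoreBound g μ v B) {M δ : ℝ} (hM : 4 * B ≤ M)
    (hδ : 0 < δ) :
    TVClose (ENNReal.ofReal δ) (rejectionSampling g μ M δ).outputLaw (tilt g μ) := by
  rcases le_or_gt 1 δ with hδ1 | hδ1
  · exact TVClose.of_one_le (ENNReal.one_le_ofReal.2 hδ1) _ _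
  have hB := h.bound_pos
  have hM0 : 0 < M := by linarith
  set N := ⌈4 * M * Real.log (4 / δ)⌉₊
  have hlog : 0 < Real.log (4 / δ) := Real.log_pos (by rw [lt_div_iff₀ hδ]; linarith)
  have hN0 : 0 < N := Nat.ceil_pos.2 (by positivity)
  have hNM : Real.log (4 / δ) ≤ N / (4 * M) := (le_div_iff₀' (by positivity)).2 (Nat.le_ceil _)
  have hNB : Real.log (4 / δ) ≤ N / (8 * B) :=
    hNM.trans (div_le_div_of_nonneg_left N.cast_nonneg (by positivity) (by linarith))
  have hexp {y : ℝ} (hy : Real.log (4 / δ) ≤ y) :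
      ENNReal.ofReal (Real.exp (-y)) ≤ ENNReal.ofReal (δ / 4) := by
    refine ENNReal.ofReal_le_ofReal ?_
    rw [Real.exp_neg, ← inv_div]
    exact inv_anti₀ (by positivity) ((Real.log_le_iff_le_exp (by positivity)).1 hy)
  have hmix := TVClose.bind_right (empiricalMean g μ N).outputLaw
    fun a => h.tvClose_acceptReject_estimate hM a N
  rw [PMF.bind_const, expect_add, expect_add, expect_const] at hmix
  simp only [rejectionSampling, Prog.outputLaw_bind, Prog.outputLaw_charge, PMF.pure_bind]
  refine hmix.mono ?_
  calc _ ≤ ENNReal.ofReal (δ / 4) + (ENNReal.ofReal (δ / 4) + ENNReal.ofReal (δ / 4)) := by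
        gcongr ?_ + (?_ + ?_)
        · exact (h.expect_empiricalMean_gt_le hN0).trans (hexp hNB)
        · exact (h.expect_empiricalMean_lt_le hN0).trans (hexp hNB)
        · exact hexp hNM
    _ ≤ ENNReal.ofReal δ := by
        rw [← ENNReal.ofReal_add (by positivity) (by positivity),
          ← ENNReal.ofReal_add (by positivity) (by positivity)]
        exact ENNReal.ofReal_le_ofReal (by linarith)

end ScoreBound

/-! ### Logarithmic errors and acceptance probabilities -/

/-- The logarithmic distance of `x` to `1`, truncated at `1`; with the value `1` for `x ≤ 0` it is
subadditive under multiplication on all of `ℝ`. -/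
noncomputable def logErr (x : ℝ) : ℝ≥0∞ :=
  if x ≤ 0 then 1 else min 1 (ENNReal.ofReal |Real.log x|)

lemma logErr_of_nonpos {x : ℝ} (hx : x ≤ 0) : logErr x = 1 := if_pos hx

lemma logErr_of_pos {x : ℝ} (hx : 0 < x) : logErr x = min 1 (ENNReal.ofReal |Real.log x|) :=
  if_neg hx.not_ge

lemma logErr_one : logErr 1 = 0 := by
  rw [logErr_of_pos one_pos, Real.log_one, abs_zero, ENNReal.ofReal_zero, min_eq_right zero_le]

lemma logErr_le_one (x : ℝ) : logErr x ≤ 1 := by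
  unfold logErr
  split_ifs
  exacts [le_rfl, min_le_left _ _]

lemma logErr_inv (x : ℝ) : logErr x⁻¹ = logErr x := by
  simp only [logErr, inv_nonpos, Real.log_inv, abs_neg]

lemma logErr_mul_le (x y : ℝ) : logErr (x * y) ≤ logErr x + logErr y := by
  rcases le_or_gt x 0 with hx | hx
  · exact (logErr_le_one _).trans ((logErr_of_nonpos hx).ge.trans le_self_add)
  rcases le_or_gt y 0 with hy | hy
  · exact (logErr_le_one _).trans ((logErr_of_nonpos hy).ge.trans le_add_self)
  have hlog : logErr (x * y) ≤ ENNReal.ofReal |Real.log x| + ENNReal.ofReal |Real.log y| := by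
    rw [logErr_of_pos (mul_pos hx hy), Real.log_mul hx.ne' hy.ne',
      ← ENNReal.ofReal_add (abs_nonneg _) (abs_nonneg _)]
    exact (min_le_right _ _).trans (ENNReal.ofReal_le_ofReal (abs_add_le _ _))
  rw [logErr_of_pos hx, logErr_of_pos hy, ← min_add_add_right, ← min_add_add_left,
    ← min_add_add_left]
  exact le_min (le_min ((logErr_le_one _).trans le_self_add) ((logErr_le_one _).trans le_self_add))
    (le_min ((logErr_le_one _).trans le_add_self) hlog)

lemma abs_log_le_two_mul_abs_sub_one {x : ℝ} (hx : 1 / 2 ≤ x) : |Real.log x| ≤ 2 * |x - 1| := by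
  have hx0 : 0 < x := by linarith
  have hinv : |1 - x⁻¹| ≤ 2 * |x - 1| := by
    rw [show 1 - x⁻¹ = x⁻¹ * (x - 1) by field_simp, abs_mul, abs_of_pos (inv_pos.2 hx0)]
    gcongr
    exact inv_le_of_inv_le₀ two_pos (by linarith)
  refine abs_le.2 ⟨?_, ?_⟩
  · exact (neg_le_neg hinv).trans ((neg_abs_le _).trans (Real.one_sub_inv_le_log_of_pos hx0))
  · linarith [Real.log_le_sub_one_of_pos hx0, le_abs_self (x - 1), abs_nonneg (x - 1)]

lemma logErr_le_ofReal_two_mul_abs (x : ℝ) : logErr x ≤ ENNReal.ofReal (2 * |x - 1|) := by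
  rcases le_or_gt (1 / 2) x with hx | hx
  · rw [logErr_of_pos (by linarith)]
    exact (min_le_right _ _).trans (ENNReal.ofReal_le_ofReal (abs_log_le_two_mul_abs_sub_one hx))
  · refine (logErr_le_one x).trans (ENNReal.one_le_ofReal.2 ?_)
    linarith [neg_abs_le (x - 1)]

lemma min_one_le_min_one_add_abs_log {a b : ℝ} (ha : 0 < a) (hb : 0 < b) :
    min a 1 ≤ min b 1 + |Real.log (a / b)| := by
  rcases le_or_gt a b with hab | hba
  · exact (min_le_min_right 1 hab).trans (le_add_of_nonneg_right (abs_nonneg _))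
  have hratio : b / a ≤ 1 := (div_le_one ha).2 hba.le
  have hmin : min a 1 * (b / a) ≤ min b 1 := by
    rw [min_mul_of_nonneg _ _ (by positivity), mul_div_cancel₀ _ ha.ne', one_mul]
    exact min_le_min_left b hratio
  calc min a 1 = min a 1 * (b / a) + min a 1 * (1 - b / a) := by ring
    _ ≤ min b 1 + 1 * (1 - b / a) := by
        gcongr
        exact min_le_right _ _
    _ ≤ min b 1 + |Real.log (a / b)| := by
        rw [one_mul, ← inv_div a b]
        gcongr
        exact (Real.one_sub_inv_le_log_of_pos (div_pos ha hb)).trans (le_abs_self _)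

lemma min_ofReal_one_le_add_logErr (a b : ℝ) :
    min (ENNReal.ofReal a) 1 ≤ min (ENNReal.ofReal b) 1 + logErr (a / b) := by
  rcases le_or_gt a 0 with ha | ha
  · exact (min_le_left _ _).trans ((ENNReal.ofReal_of_nonpos ha).trans_le zero_le)
  rcases le_or_gt b 0 with hb | hb
  · rw [logErr_of_nonpos (div_nonpos_of_nonneg_of_nonpos ha.le hb)]
    exact (min_le_right _ _).trans le_add_self
  rw [logErr_of_pos (div_pos ha hb), ← min_add_add_left]
  refine le_min ((min_le_right _ _).trans le_add_self) ?_
  rw [← ENNReal.ofReal_one, ← ENNReal.ofReal_min, ← ENNReal.ofReal_min,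
    ← ENNReal.ofReal_add (by positivity) (abs_nonneg _)]
  exact ENNReal.ofReal_le_ofReal (min_one_le_min_one_add_abs_log ha hb)

theorem tvClose_bernoulli (a b : ℝ) :
    TVClose (logErr (a / b)) (Prog.bernoulli a) (Prog.bernoulli b) := by
  have hab := min_ofReal_one_le_add_logErr a b
  have hba := min_ofReal_one_le_add_logErr b a
  rw [← inv_div, logErr_inv] at hba
  intro f hf
  rw [expect_bernoulli, expect_bernoulli]
  set p := min (ENNReal.ofReal a) 1
  set q := min (ENNReal.ofReal b) 1
  set c := logErr (a / b)
  rcases le_total p q with hpq | hqp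
  · have hcompl : 1 - p ≤ 1 - q + c := by
      rw [tsub_le_iff_right, add_assoc, add_comm c]
      exact le_tsub_add.trans (by gcongr)
    calc p * f true + (1 - p) * f false ≤ q * f true + (1 - q + c) * f false := by gcongr
      _ = q * f true + (1 - q) * f false + c * f false := by ring
      _ ≤ q * f true + (1 - q) * f false + c := by
          gcongr
          exact mul_le_of_le_one_right' (hf false)
  · calc p * f true + (1 - p) * f false ≤ (q + c) * f true + (1 - q) * f false := by gcongr
      _ = q * f true + (1 - q) * f false + c * f true := by ring
      _ ≤ q * f true + (1 - q) * f false + c := by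
          gcongr
          exact mul_le_of_le_one_right' (hf true)

/-! ### The Metropolis-Hastings kernel with an independent proposal -/

/-- One Metropolis-Hastings step from `a` with the independent proposal `Q`, for the target
proportional to `Q * r`. -/
noncomputable def mhKernel {Ω : Type*} (Q : PMF Ω) (r : Ω → ℝ) (a : Ω) : PMF Ω :=
  Q.bind fun s => (Prog.bernoulli (r s / r a)).bind fun b =>
    if b then PMF.pure s else PMF.pure a

section Metropolis

variable {Ω : Type*} {Q : PMF Ω} {r : Ω → ℝ}

lemma expect_mhKernel (Q : PMF Ω) (r : Ω → ℝ) (a : Ω) (f : Ω → ℝ≥0∞) :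
    expect (mhKernel Q r a) f = expect Q fun s =>
      min (ENNReal.ofReal (r s / r a)) 1 * f s +
        (1 - min (ENNReal.ofReal (r s / r a)) 1) * f a := by
  simp only [mhKernel, expect_bind, expect_bernoulli, if_true, Bool.false_eq_true, if_false,
    expect_pure]

lemma ofReal_mul_min_ofReal_div_one {x : ℝ} (hx : 0 < x) (y : ℝ) :
    ENNReal.ofReal x * min (ENNReal.ofReal (y / x)) 1 = ENNReal.ofReal (min y x) := by
  rw [← ENNReal.ofReal_one, ← ENNReal.ofReal_min, ← ENNReal.ofReal_mul hx.le,
    mul_min_of_nonneg _ _ hx.le, mul_div_cancel₀ _ hx.ne', mul_one]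

theorem bind_mhKernel {π : PMF Ω} (hr : ∀ s, 0 < r s) {c : ℝ≥0∞}
    (hπ : ∀ s, π s = c * (Q s * ENNReal.ofReal (r s))) : π.bind (mhKernel Q r) = π := by
  have hdensity (F : Ω → ℝ≥0∞) :
      expect π F = c * expect Q fun a => ENNReal.ofReal (r a) * F a := by
    simp only [expect, hπ, ← ENNReal.tsum_mul_left, mul_assoc]
  refine eq_of_forall_expect_eq fun f => ?_
  -- Detailed balance: the flow from `a` to `s` has the density `min (r s) (r a)`.
  have hbalance :
      expect π (fun a => expect Q fun s => min (ENNReal.ofReal (r s / r a)) 1 * f s) =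
        expect π (fun a => expect Q fun s => min (ENNReal.ofReal (r s / r a)) 1 * f a) := by
    rw [hdensity, hdensity]
    simp only [← expect_const_mul, ← mul_assoc, ofReal_mul_min_ofReal_div_one (hr _)]
    rw [expect_comm]
    simp only [min_comm]
  simp only [expect_bind, expect_mhKernel, expect_add]
  rw [hbalance]
  simp only [← expect_add, ← add_mul, add_tsub_cancel_of_le (min_le_right _ _), one_mul,
    expect_const]

theorem le_mhKernel {β : ℝ} (hβ : β ≤ 1) (hr : ∀ a s, β ≤ r s / r a) (a s : Ω) :
    ENNReal.ofReal β * Q s ≤ mhKernel Q r a s := by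
  rw [← expect_indicator_singleton Q, ← expect_indicator_singleton (mhKernel Q r a),
    expect_mhKernel, ← expect_const_mul]
  refine expect_mono _ fun y => le_trans ?_ le_self_add
  gcongr
  exact le_min (ENNReal.ofReal_le_ofReal (hr a y)) (ENNReal.ofReal_le_one.2 hβ)

end Metropolis

lemma bind_map_mk_apply {α β : Type*} (μ : PMF α) (k : α → PMF β) (a : α) (b : β) :
    (μ.bind fun a => (k a).map fun b => (a, b)) (a, b) = μ a * k a b := by
  classical
  rw [PMF.bind_apply, tsum_eq_single a]
  · congr 1
    rw [PMF.map_apply, tsum_eq_single b] <;> simp +contextual [eq_comm]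
  · intro a' ha'
    simp [PMF.map_apply, ha'.symm]

namespace ReasoningModel

/-! ### The exact proposal and its importance weights -/

variable {S : ℕ → Type} (m : ReasoningModel S) (s₀ : S 0)

/-- The law of the proposed trajectory when every step is drawn from the exact tilt. -/
noncomputable def proposal : (t : ℕ) → PMF (Prefix S t)
  | 0 => PMF.pure ()
  | t + 1 => (proposal t).bind fun s =>
      (tilt (fun y => m.V s₀ (t + 1) (s, y)) (m.ref s₀ t s)).map fun x => (s, x)

/-- The density `∏ V(s_{1:k}) / Z_k(s_{1:k-1})` of the proposal with respect to the base model,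
which the cumulative weights of the algorithm estimate. -/
noncomputable def proposalWeight : (t : ℕ) → Prefix S t → ℝ
  | 0, _ => 1
  | t + 1, (s, x) => proposalWeight t s * (m.V s₀ (t + 1) (s, x) / m.nextValue s₀ t s)

/-- The density of the target with respect to the proposal, up to a constant factor. -/
noncomputable def importance (t : ℕ) (s : Prefix S t) : ℝ :=
  m.V s₀ t s / m.proposalWeight s₀ t s

lemma proposal_succ_apply (t : ℕ) (s : Prefix S t) (x : S (t + 1)) :
    m.proposal s₀ (t + 1) (s, x) =
      m.proposal s₀ t s * tilt (fun y => m.V s₀ (t + 1) (s, y)) (m.ref s₀ t s) x :=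
  bind_map_mk_apply _ _ _ _

lemma refPath_succ_apply (t : ℕ) (s : Prefix S t) (x : S (t + 1)) :
    m.refPath s₀ (t + 1) (s, x) = m.refPath s₀ t s * m.ref s₀ t s x :=
  bind_map_mk_apply _ _ _ _

lemma importance_zero (s : Prefix S 0) : m.importance s₀ 0 s = m.V s₀ 0 () :=
  div_one _

lemma importance_succ (t : ℕ) (s : Prefix S t) (x : S (t + 1)) :
    m.importance s₀ (t + 1) (s, x) =
      m.importance s₀ t s * (m.nextValue s₀ t s / m.V s₀ t s) := by
  have hV := (m.V_pos s₀ t s).ne'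
  have hV' := (m.V_pos s₀ (t + 1) (s, x)).ne'
  change m.V s₀ (t + 1) (s, x) /
      (m.proposalWeight s₀ t s * (m.V s₀ (t + 1) (s, x) / m.nextValue s₀ t s)) =
    m.V s₀ t s / m.proposalWeight s₀ t s * (m.nextValue s₀ t s / m.V s₀ t s)
  field_simp

variable {m s₀} {T : ℕ} {L ε : ℝ}

lemma scoreBound (hL : m.RatioBound s₀ T L) (hε : m.BellmanBound s₀ T ε)
    {t : ℕ} (ht : t < T) (s : Prefix S t) :
    ScoreBound (fun x => m.V s₀ (t + 1) (s, x)) (m.ref s₀ t s) (m.nextValue s₀ t s)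
      (L * (1 + ε)) := by
  obtain ⟨x₀, hx₀⟩ := (m.ref s₀ t s).support_nonempty
  have hL0 : 0 ≤ L :=
    (div_pos (m.V_pos s₀ (t + 1) (s, x₀)) (m.V_pos s₀ t s)).le.trans (hL t ht s x₀).2
  have hV (x : S (t + 1)) : m.V s₀ (t + 1) (s, x) ≤ L * m.V s₀ t s :=
    (div_le_iff₀ (m.V_pos _ _ _)).1 (hL t ht s x).2
  have hfin : expect (m.ref s₀ t s) (fun x => ENNReal.ofReal (m.V s₀ (t + 1) (s, x))) ≠ ∞ :=
    ne_top_of_le_ne_top ENNReal.ofReal_ne_top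
      (expect_le_of_forall_le _ fun x => ENNReal.ofReal_le_ofReal (hV x))
  have hpos : expect (m.ref s₀ t s) (fun x => ENNReal.ofReal (m.V s₀ (t + 1) (s, x))) ≠ 0 :=
    ENNReal.summable.tsum_ne_zero_iff.2 ⟨x₀, mul_ne_zero ((PMF.mem_support_iff _ _).1 hx₀)
      (ENNReal.ofReal_pos.2 (m.V_pos _ _ _)).ne'⟩
  have hnext : m.nextValue s₀ t s =
      (expect (m.ref s₀ t s) fun x => ENNReal.ofReal (m.V s₀ (t + 1) (s, x))).toReal := by
    rw [expect, ENNReal.tsum_toReal_eq (ENNReal.ne_top_of_tsum_ne_top hfin), nextValue]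
    exact tsum_congr fun x => by
      rw [ENNReal.toReal_mul, ENNReal.toReal_ofReal (m.V_pos s₀ (t + 1) (s, x)).le]
  have hZ : 0 < m.nextValue s₀ t s := hnext ▸ ENNReal.toReal_pos hpos hfin
  refine ⟨hZ, fun x => (m.V_pos _ _ _).le, fun x => (hV x).trans ?_, ?_⟩
  · rw [mul_assoc]
    exact mul_le_mul_of_nonneg_left ((div_le_iff₀ hZ).1 (hε t ht s).1) hL0
  · rw [hnext, ENNReal.ofReal_toReal hfin]

lemma proposalWeight_pos (hL : m.RatioBound s₀ T L) (hε : m.BellmanBound s₀ T ε) :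
    ∀ t ≤ T, ∀ s : Prefix S t, 0 < m.proposalWeight s₀ t s
  | 0, _, _ => one_pos
  | t + 1, ht, (s, _) =>
    mul_pos (proposalWeight_pos hL hε t (Nat.le_of_succ_le ht) s)
      (div_pos (m.V_pos _ _ _) (scoreBound hL hε ht s).v_pos)

lemma importance_pos (hL : m.RatioBound s₀ T L) (hε : m.BellmanBound s₀ T ε) {t : ℕ} (ht : t ≤ T)
    (s : Prefix S t) : 0 < m.importance s₀ t s :=
  div_pos (m.V_pos _ _ _) (proposalWeight_pos hL hε t ht s)

lemma proposal_apply (hL : m.RatioBound s₀ T L) (hε : m.BellmanBound s₀ T ε) :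
    ∀ t ≤ T, ∀ s : Prefix S t,
      m.proposal s₀ t s = m.refPath s₀ t s * ENNReal.ofReal (m.proposalWeight s₀ t s)
  | 0, _, s => by simp [proposal, refPath, proposalWeight]
  | t + 1, ht, (s, x) => by
    have ht' := Nat.le_of_succ_le ht
    have hscore := scoreBound hL hε ht s
    rw [proposal_succ_apply, refPath_succ_apply, proposalWeight, proposal_apply hL hε t ht' s,
      hscore.tilt_apply, ENNReal.ofReal_mul (proposalWeight_pos hL hε t ht' s).le,
      ENNReal.ofReal_div_of_pos hscore.v_pos, ENNReal.div_eq_inv_mul]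
    ring

lemma target_apply (hL : m.RatioBound s₀ T L) (hε : m.BellmanBound s₀ T ε) (s : Prefix S T) :
    m.target s₀ T hL s = (∑' s, m.weight s₀ T s)⁻¹ *
      (m.proposal s₀ T s * ENNReal.ofReal (m.importance s₀ T s)) := by
  have hW := proposalWeight_pos hL hε T le_rfl s
  rw [target, PMF.normalize_apply, weight, proposal_apply hL hε T le_rfl, mul_assoc,
    mul_assoc (m.refPath s₀ T s), ← ENNReal.ofReal_mul hW.le, importance,
    mul_div_cancel₀ _ hW.ne']
  ring

lemma bind_mhKernel_target (hL : m.RatioBound s₀ T L) (hε : m.BellmanBound s₀ T ε) :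
    (m.target s₀ T hL).bind (mhKernel (m.proposal s₀ T) (m.importance s₀ T)) =
      m.target s₀ T hL :=
  bind_mhKernel (importance_pos hL hε le_rfl) (target_apply hL hε)

lemma importance_le (hL : m.RatioBound s₀ T L) (hε : m.BellmanBound s₀ T ε) :
    ∀ t ≤ T, ∀ s : Prefix S t, m.importance s₀ t s ≤ m.V s₀ 0 () * (1 + ε) ^ t
  | 0, _, _ => by rw [importance_zero, pow_zero, mul_one]
  | t + 1, ht, (s, x) => by
    have ht' := Nat.le_of_succ_le ht
    have ih := importance_le hL hε t ht' s
    have hratio : 0 ≤ m.nextValue s₀ t s / m.V s₀ t s :=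
      (div_pos (scoreBound hL hε ht s).v_pos (m.V_pos _ _ _)).le
    rw [importance_succ, pow_succ, ← mul_assoc]
    exact mul_le_mul ih (hε t ht s).2 hratio ((importance_pos hL hε ht' s).le.trans ih)

lemma le_importance_mul (hL : m.RatioBound s₀ T L) (hε : m.BellmanBound s₀ T ε) :
    ∀ t ≤ T, ∀ s : Prefix S t, m.V s₀ 0 () ≤ m.importance s₀ t s * (1 + ε) ^ t
  | 0, _, _ => by rw [importance_zero, pow_zero, mul_one]
  | t + 1, ht, (s, x) => by
    have hZ := (scoreBound hL hε ht s).v_pos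
    have hV := m.V_pos s₀ t s
    have hε0 : 0 ≤ 1 + ε := (div_pos hV hZ).le.trans (hε t ht s).1
    have himportance := importance_pos hL hε ht (s, x)
    calc m.V s₀ 0 () ≤ m.importance s₀ t s * (1 + ε) ^ t :=
          le_importance_mul hL hε t (Nat.le_of_succ_le ht) s
      _ = m.importance s₀ (t + 1) (s, x) * (m.V s₀ t s / m.nextValue s₀ t s) * (1 + ε) ^ t := by
          rw [importance_succ, mul_assoc (m.importance s₀ t s), div_mul_div_cancel₀ hV.ne',
            div_self hZ.ne', mul_one]
      _ ≤ m.importance s₀ (t + 1) (s, x) * (1 + ε) * (1 + ε) ^ t := by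
          gcongr
          exact (hε t ht s).1
      _ = m.importance s₀ (t + 1) (s, x) * (1 + ε) ^ (t + 1) := by ring

theorem le_importance_div (hL : m.RatioBound s₀ T L) (hε : m.BellmanBound s₀ T ε) {β : ℝ}
    (hβ : 0 ≤ β) (hβε : β * (1 + ε) ^ (2 * T) ≤ 1) (a s : Prefix S T) :
    β ≤ m.importance s₀ T s / m.importance s₀ T a := by
  have hs := le_importance_mul hL hε T le_rfl s
  have hs0 := importance_pos hL hε le_rfl s
  have hpow : 0 < (1 + ε) ^ T := pos_of_mul_pos_right ((m.V_pos s₀ 0 ()).trans_le hs) hs0.le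
  rw [le_div_iff₀ (importance_pos hL hε le_rfl a)]
  calc β * m.importance s₀ T a
      ≤ β * (m.V s₀ 0 () * (1 + ε) ^ T) := by
        gcongr
        exact importance_le hL hε T le_rfl a
    _ ≤ β * (m.importance s₀ T s * (1 + ε) ^ T * (1 + ε) ^ T) := by gcongr
    _ = β * (1 + ε) ^ (2 * T) * m.importance s₀ T s := by ring
    _ ≤ m.importance s₀ T s := mul_le_of_le_one_left hs0.le hβε

/-! ### The inner loop -/

variable (m s₀)

/-- The output law of the inner loop with an accepted prefix when exact tilting replaces rejection
sampling. -/
noncomputable def exactInnerLoop (Nm : ℕ) :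
    (t : ℕ) → Prefix S t → PMF (Prefix S t × ℝ × ℝ)
  | 0, _ => PMF.pure ((), 1, 1)
  | t + 1, (a, y) => (exactInnerLoop Nm t a).bind fun (s, w, w') =>
      (tilt (fun y => m.V s₀ (t + 1) (s, y)) (m.ref s₀ t s)).bind fun x =>
      (m.estNormalizer s₀ Nm t s).outputLaw.bind fun z =>
      (m.estNormalizer s₀ Nm t a).outputLaw.bind fun z' =>
      PMF.pure ((s, x), w * (m.V s₀ (t + 1) (s, x) / z), w' * (m.V s₀ (t + 1) (a, y) / z'))

/-- The logarithmic error of the cumulative weight `w` of the prefix `s`. -/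
noncomputable def weightErr (t : ℕ) (s : Prefix S t) (w : ℝ) : ℝ≥0∞ :=
  logErr (w / m.proposalWeight s₀ t s)

lemma outputLaw_innerLoop_zero (Nm : ℕ) (M δ : ℝ) (acc : Option (Prefix S 0)) :
    (m.innerLoop s₀ Nm M δ 0 acc).outputLaw = PMF.pure ((), 1, 1) :=
  Prog.outputLaw_pure _

lemma outputLaw_innerLoop_succ (Nm : ℕ) (M δ : ℝ) (t : ℕ) (a : Prefix S t) (y : S (t + 1)) :
    (m.innerLoop s₀ Nm M δ (t + 1) (some (a, y))).outputLaw =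
      (m.innerLoop s₀ Nm M δ t (some a)).outputLaw.bind fun (s, w, w') =>
      (rejectionSampling (fun y => m.V s₀ (t + 1) (s, y)) (m.ref s₀ t s) M δ).outputLaw.bind
        fun x =>
      (m.estNormalizer s₀ Nm t s).outputLaw.bind fun z =>
      (m.estNormalizer s₀ Nm t a).outputLaw.bind fun z' =>
      PMF.pure ((s, x), w * (m.V s₀ (t + 1) (s, x) / z), w' * (m.V s₀ (t + 1) (a, y) / z')) := by
  simp only [innerLoop, Prog.outputLaw_bind, Prog.outputLaw_charge, PMF.pure_bind,
    Prog.outputLaw_pure]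
  rfl

lemma map_fst_exactInnerLoop (Nm : ℕ) : ∀ (t : ℕ) (a : Prefix S t),
    (m.exactInnerLoop s₀ Nm t a).map Prod.fst = m.proposal s₀ t
  | 0, _ => PMF.pure_map _ _
  | t + 1, (a, y) => by
    rw [exactInnerLoop, proposal, ← map_fst_exactInnerLoop Nm t a, PMF.map_bind, PMF.bind_map]
    congr 1
    funext p
    simp only [PMF.map_bind, PMF.pure_map, PMF.bind_const]
    exact PMF.bind_pure_comp _ _

lemma weightErr_succ_le (t : ℕ) (s : Prefix S t) (x : S (t + 1)) (w z : ℝ) :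
    m.weightErr s₀ (t + 1) (s, x) (w * (m.V s₀ (t + 1) (s, x) / z)) ≤
      m.weightErr s₀ t s w + logErr (z / m.nextValue s₀ t s) := by
  change logErr (w * (m.V s₀ (t + 1) (s, x) / z) /
      (m.proposalWeight s₀ t s * (m.V s₀ (t + 1) (s, x) / m.nextValue s₀ t s))) ≤
    logErr (w / m.proposalWeight s₀ t s) + logErr (z / m.nextValue s₀ t s)
  have hV := (m.V_pos s₀ (t + 1) (s, x)).ne'
  rw [mul_div_mul_comm, div_div_div_cancel_left' _ _ hV, ← logErr_inv (z / _), inv_div]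
  exact logErr_mul_le _ _

variable {m s₀}

lemma tvClose_innerLoop (hL : m.RatioBound s₀ T L) (hε : m.BellmanBound s₀ T ε) (Nm : ℕ)
    {M δ : ℝ} (hM : 4 * (L * (1 + ε)) ≤ M) (hδ : 0 < δ) :
    ∀ t ≤ T, ∀ a : Prefix S t, TVClose (ENNReal.ofReal (t * δ))
      (m.innerLoop s₀ Nm M δ t (some a)).outputLaw (m.exactInnerLoop s₀ Nm t a)
  | 0, _, a => by
    rw [outputLaw_innerLoop_zero]
    exact (TVClose.refl _).mono zero_le
  | t + 1, ht, (a, y) => by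
    rw [outputLaw_innerLoop_succ, exactInnerLoop, Nat.cast_succ, add_one_mul,
      ENNReal.ofReal_add (by positivity) hδ.le]
    exact (tvClose_innerLoop hL hε Nm hM hδ t (Nat.le_of_succ_le ht) a).bind fun p =>
      ((scoreBound hL hε ht p.1).tvClose_rejectionSampling hM hδ).bind_left _

lemma expect_logErr_estNormalizer_le (hL : m.RatioBound s₀ T L) (hε : m.BellmanBound s₀ T ε)
    {Nm : ℕ} (hNm : L * (1 + ε) ≤ Nm) {t : ℕ} (ht : t < T) (s : Prefix S t) :
    expect (m.estNormalizer s₀ Nm t s).outputLaw (fun z => logErr (z / m.nextValue s₀ t s)) ≤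
      ENNReal.ofReal (12 * √(L * (1 + ε) / Nm)) := by
  calc expect (m.estNormalizer s₀ Nm t s).outputLaw (fun z => logErr (z / m.nextValue s₀ t s))
      ≤ expect (m.estNormalizer s₀ Nm t s).outputLaw
          (fun z => ENNReal.ofReal 2 * ENNReal.ofReal |z / m.nextValue s₀ t s - 1|) :=
        expect_mono _ fun z =>
          (logErr_le_ofReal_two_mul_abs _).trans_eq (ENNReal.ofReal_mul two_pos.le)
    _ ≤ ENNReal.ofReal 2 * ENNReal.ofReal (6 * √(L * (1 + ε) / Nm)) := by
        rw [expect_const_mul]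
        gcongr
        exact (scoreBound hL hε ht s).expect_abs_empiricalMean_le hNm
    _ = ENNReal.ofReal (12 * √(L * (1 + ε) / Nm)) := by
        rw [← ENNReal.ofReal_mul two_pos.le, ← mul_assoc]
        norm_num

lemma expect_weightErr_succ_le (hL : m.RatioBound s₀ T L) (hε : m.BellmanBound s₀ T ε)
    {Nm : ℕ} (hNm : L * (1 + ε) ≤ Nm) {t : ℕ} (ht : t < T) (s : Prefix S t) (x : S (t + 1))
    (w : ℝ) :
    expect (m.estNormalizer s₀ Nm t s).outputLaw
      (fun z => m.weightErr s₀ (t + 1) (s, x) (w * (m.V s₀ (t + 1) (s, x) / z))) ≤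
      m.weightErr s₀ t s w + ENNReal.ofReal (12 * √(L * (1 + ε) / Nm)) := by
  refine (expect_mono _ fun z => m.weightErr_succ_le s₀ t s x w z).trans ?_
  rw [expect_add, expect_const]
  gcongr
  exact expect_logErr_estNormalizer_le hL hε hNm ht s

theorem expect_weightErr_exactInnerLoop_le (hL : m.RatioBound s₀ T L)
    (hε : m.BellmanBound s₀ T ε) {Nm : ℕ} (hNm : L * (1 + ε) ≤ Nm) :
    ∀ t ≤ T, ∀ a : Prefix S t,
      expect (m.exactInnerLoop s₀ Nm t a)
        (fun (s, w, w') => m.weightErr s₀ t s w + m.weightErr s₀ t a w') ≤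
        ENNReal.ofReal (t * (24 * √(L * (1 + ε) / Nm)))
  | 0, _, a => by
    simp [exactInnerLoop, expect_pure, weightErr, proposalWeight, logErr_one]
  | t + 1, ht, (a, y) => by
    have ih := expect_weightErr_exactInnerLoop_le hL hε hNm t (Nat.le_of_succ_le ht) a
    have hstep := expect_weightErr_succ_le hL hε hNm ht
    set b := 12 * √(L * (1 + ε) / Nm) with hb
    have hb0 : 0 ≤ b := by positivity
    calc expect (m.exactInnerLoop s₀ Nm (t + 1) (a, y)) (fun (s, w, w') =>
          m.weightErr s₀ (t + 1) s w + m.weightErr s₀ (t + 1) (a, y) w')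
        ≤ expect (m.exactInnerLoop s₀ Nm t a) (fun (s, w, w') =>
            m.weightErr s₀ t s w + m.weightErr s₀ t a w' +
              (ENNReal.ofReal b + ENNReal.ofReal b)) := by
          simp only [exactInnerLoop, expect_bind, expect_pure]
          refine expect_mono _ fun p => ?_
          simp only [expect_add, expect_const]
          rw [add_add_add_comm]
          exact add_le_add (expect_le_of_forall_le _ fun x => hstep p.1 x p.2.1) (hstep a y p.2.2)
      _ = expect (m.exactInnerLoop s₀ Nm t a) (fun (s, w, w') =>
            m.weightErr s₀ t s w + m.weightErr s₀ t a w') + ENNReal.ofReal (b + b) := by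
          simp only [expect_add, expect_const, ENNReal.ofReal_add hb0 hb0]
      _ ≤ ENNReal.ofReal (t * (24 * √(L * (1 + ε) / Nm)) + (b + b)) := by
          rw [ENNReal.ofReal_add (by positivity) (add_nonneg hb0 hb0)]
          exact add_le_add ih le_rfl
      _ = ENNReal.ofReal ((t + 1 : ℕ) * (24 * √(L * (1 + ε) / Nm))) := by
          congr 1
          rw [hb]
          push_cast
          ring

/-! ### The outer loop -/

variable (m s₀) in
/-- The law of the accepted trajectory after one more iteration of the outer loop, from the
accepted trajectory `a`. -/
noncomputable def outerKernel (Nm : ℕ) (M δ : ℝ) (T : ℕ) (a : Prefix S T) : PMF (Prefix S T) :=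
  (m.innerLoop s₀ Nm M δ T (some a)).outputLaw.bind fun (s, w, w') =>
    (Prog.bernoulli (w' / m.V s₀ T a * (m.V s₀ T s / w))).bind fun b =>
      if b then PMF.pure s else PMF.pure a

variable (m s₀) in
lemma outputLaw_outerLoop_succ (Nm : ℕ) (M δ : ℝ) (T k : ℕ) :
    (m.outerLoop s₀ Nm M δ T (k + 1)).outputLaw =
      (m.outerLoop s₀ Nm M δ T k).outputLaw.bind (m.outerKernel s₀ Nm M δ T) := by
  simp only [outerLoop, Prog.outputLaw_bind, Prog.outputLaw_charge, PMF.pure_bind,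
    Prog.outputLaw_coin]
  congr 1
  funext a
  rw [outerKernel]
  congr 1
  funext p
  congr 1
  funext b
  cases b <;> exact Prog.outputLaw_pure _

lemma tvClose_bernoulli_importance (hL : m.RatioBound s₀ T L) (hε : m.BellmanBound s₀ T ε)
    (a s : Prefix S T) (w w' : ℝ) :
    TVClose (m.weightErr s₀ T s w + m.weightErr s₀ T a w')
      (Prog.bernoulli (w' / m.V s₀ T a * (m.V s₀ T s / w)))
      (Prog.bernoulli (m.importance s₀ T s / m.importance s₀ T a)) := by
  refine (tvClose_bernoulli _ _).mono ?_
  have hVa := (m.V_pos s₀ T a).ne'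
  have hVs := (m.V_pos s₀ T s).ne'
  have hWa := (proposalWeight_pos hL hε T le_rfl a).ne'
  have hWs := (proposalWeight_pos hL hε T le_rfl s).ne'
  have hratio : w' / m.V s₀ T a * (m.V s₀ T s / w) / (m.importance s₀ T s / m.importance s₀ T a) =
      (w / m.proposalWeight s₀ T s)⁻¹ * (w' / m.proposalWeight s₀ T a) := by
    rw [importance, importance]
    field_simp
  rw [hratio, weightErr, weightErr, ← logErr_inv (w / _)]
  exact logErr_mul_le _ _

theorem tvClose_outerKernel (hL : m.RatioBound s₀ T L) (hε : m.BellmanBound s₀ T ε)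
    {Nm : ℕ} (hNm : L * (1 + ε) ≤ Nm) {M δ : ℝ} (hM : 4 * (L * (1 + ε)) ≤ M) (hδ : 0 < δ)
    (a : Prefix S T) :
    TVClose (ENNReal.ofReal (T * δ + T * (24 * √(L * (1 + ε) / Nm))))
      (m.outerKernel s₀ Nm M δ T a) (mhKernel (m.proposal s₀ T) (m.importance s₀ T) a) := by
  have hexact : mhKernel (m.proposal s₀ T) (m.importance s₀ T) a =
      (m.exactInnerLoop s₀ Nm T a).bind fun (s, _, _) =>
        (Prog.bernoulli (m.importance s₀ T s / m.importance s₀ T a)).bind fun b =>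
          if b then PMF.pure s else PMF.pure a := by
    rw [mhKernel, ← map_fst_exactInnerLoop m s₀ Nm T a, PMF.bind_map]
    rfl
  have hproposal := (tvClose_innerLoop hL hε Nm hM hδ T le_rfl a).bind_left fun (s, w, w') =>
    (Prog.bernoulli (w' / m.V s₀ T a * (m.V s₀ T s / w))).bind fun b =>
      if b then PMF.pure s else PMF.pure a
  rw [hexact, ENNReal.ofReal_add (by positivity) (by positivity)]
  refine hproposal.trans (TVClose.mono (TVClose.bind_right _ fun p => ?_)
    (expect_weightErr_exactInnerLoop_le hL hε hNm T le_rfl a))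
  exact (tvClose_bernoulli_importance hL hε a p.1 p.2.1 p.2.2).bind_left _

theorem tvClose_outerLoop (hL : m.RatioBound s₀ T L) (hε : m.BellmanBound s₀ T ε)
    {β : ℝ} (hβ : 0 < β) (hβ1 : β ≤ 1) (hβε : β * (1 + ε) ^ (2 * T) ≤ 1)
    {Nm : ℕ} (hNm : L * (1 + ε) ≤ Nm) {M δ : ℝ} (hM : 4 * (L * (1 + ε)) ≤ M) (hδ : 0 < δ)
    (k : ℕ) :
    TVClose (ENNReal.ofReal ((T * δ + T * (24 * √(L * (1 + ε) / Nm))) / β + (1 - β) ^ k))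
      (m.outerLoop s₀ Nm M δ T k).outputLaw (m.target s₀ T hL) := by
  set η := T * δ + T * (24 * √(L * (1 + ε) / Nm))
  have hη0 : 0 ≤ η := by positivity
  have hβ1' : 0 ≤ 1 - β := sub_nonneg.2 hβ1
  induction k with
  | zero =>
    refine TVClose.of_one_le (ENNReal.one_le_ofReal.2 ?_) _ _
    rw [pow_zero]
    exact le_add_of_nonneg_left (by positivity)
  | succ k ih =>
    have hcontract := ih.contract
      (le_mhKernel (Q := m.proposal s₀ T) hβ1 (le_importance_div hL hε hβ.le hβε))
    have hperturb := TVClose.bind_right (m.outerLoop s₀ Nm M δ T k).outputLaw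
      (tvClose_outerKernel hL hε hNm hM hδ)
    rw [bind_mhKernel_target hL hε] at hcontract
    rw [expect_const] at hperturb
    rw [outputLaw_outerLoop_succ]
    refine (hperturb.trans hcontract).mono ?_
    rw [← ENNReal.ofReal_one, ← ENNReal.ofReal_sub _ hβ.le, ← ENNReal.ofReal_mul hβ1',
      ← ENNReal.ofReal_add hη0 (by positivity)]
    refine ENNReal.ofReal_le_ofReal (le_of_eq ?_)
    field_simp
    ring

end ReasoningModel

/-! ### The choice of the parameters -/

namespace SPgSMC

/-- A lower bound for the acceptance probabilities of the exact Metropolis-Hastings chain: its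
importance weights are within `(1 + ε) ^ T ≤ exp κ` of a constant. -/
noncomputable def acceptanceFloor (κ : ℝ) : ℝ := Real.exp (-(2 * κ))

/-- The parameter `M` of rejection sampling. The tilts have relative densities at most
`L * (1 + κ)`; the factor `4` leaves room for the estimated normaliser. -/
noncomputable def envelope (κ L : ℝ) : ℝ := 4 * (L * (1 + κ))

/-- The parameter `δ'` of rejection sampling. -/
noncomputable def rejectionError (κ : ℝ) (T : ℕ) (δ δTV : ℝ) : ℝ :=
  acceptanceFloor κ * δTV / 4 * (δ / (T * Real.log (1 / δ)))

/-- The number of samples for each estimate of a normaliser, for which its mean relative error is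
a small multiple of `δTV / T`. -/
noncomputable def normalizerSamples (κ : ℝ) (T : ℕ) (L δTV : ℝ) : ℕ :=
  ⌈L * (1 + κ) * (96 * T / (acceptanceFloor κ * δTV)) ^ 2⌉₊

/-- The number of Metropolis-Hastings steps. -/
noncomputable def mixingSteps (κ δTV : ℝ) : ℕ :=
  ⌈Real.log (2 / δTV) / acceptanceFloor κ⌉₊

variable {κ L ε δ δTV : ℝ} {T : ℕ}

lemma acceptanceFloor_pos (κ : ℝ) : 0 < acceptanceFloor κ := Real.exp_pos _

lemma acceptanceFloor_le_one (hκ : 0 ≤ κ) : acceptanceFloor κ ≤ 1 :=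
  Real.exp_le_one_iff.2 (by linarith)

lemma acceptanceFloor_mul_pow_le_one (hT : 1 ≤ T) (hε : 0 ≤ ε) (hεκ : ε ≤ κ / T) :
    acceptanceFloor κ * (1 + ε) ^ (2 * T) ≤ 1 := by
  have hTε : T * ε ≤ κ := (le_div_iff₀' (Nat.cast_pos.2 hT)).1 hεκ
  have hpow : (1 + ε) ^ (2 * T) ≤ Real.exp (2 * κ) := by
    calc (1 + ε) ^ (2 * T) ≤ Real.exp ε ^ (2 * T) := by
          gcongr
          linarith [Real.add_one_le_exp ε]
      _ = Real.exp (2 * (T * ε)) := by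
          rw [← Real.exp_nat_mul, Nat.cast_mul, Nat.cast_ofNat, mul_assoc]
      _ ≤ Real.exp (2 * κ) := by gcongr
  rwa [acceptanceFloor, Real.exp_neg, inv_mul_le_one₀ (Real.exp_pos _)]

lemma le_of_le_div_natCast (hκ : 0 ≤ κ) (hT : 1 ≤ T) (hεκ : ε ≤ κ / T) : ε ≤ κ :=
  hεκ.trans (div_le_self hκ (Nat.one_le_cast.2 hT))

lemma half_le_log_one_div (hδ : 0 < δ) (hδ2 : δ ≤ 1 / 2) : 1 / 2 ≤ Real.log (1 / δ) := by
  have hlog : Real.log 2 ≤ Real.log (1 / δ) :=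
    Real.log_le_log two_pos (by rwa [le_one_div two_pos hδ])
  linarith [Real.log_two_gt_d9]

lemma one_le_natCast_div (hT : 1 ≤ T) (hTV : 0 < δTV) (hTV1 : δTV ≤ 1) : 1 ≤ T / δTV :=
  (one_le_div hTV).2 (hTV1.trans (Nat.one_le_cast.2 hT))

/-! ### The error budget -/

lemma rejectionError_pos (hT : 1 ≤ T) (hδ : 0 < δ) (hδ2 : δ ≤ 1 / 2) (hTV : 0 < δTV) :
    0 < rejectionError κ T δ δTV := by
  have hβ := acceptanceFloor_pos κ
  have hΛ : 0 < Real.log (1 / δ) := one_half_pos.trans_le (half_le_log_one_div hδ hδ2)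
  unfold rejectionError
  positivity

lemma mul_rejectionError_le (hT : 1 ≤ T) (hδ : 0 < δ) (hδ2 : δ ≤ 1 / 2) (hTV : 0 < δTV) :
    T * rejectionError κ T δ δTV ≤ acceptanceFloor κ * δTV / 4 := by
  have hβ := acceptanceFloor_pos κ
  have hΛ := half_le_log_one_div hδ hδ2
  have hT' : (T : ℝ) ≠ 0 := Nat.cast_ne_zero.2 (Nat.one_le_iff_ne_zero.1 hT)
  calc T * rejectionError κ T δ δTV = acceptanceFloor κ * δTV / 4 * (δ / Real.log (1 / δ)) := by
        rw [rejectionError]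
        field_simp
    _ ≤ acceptanceFloor κ * δTV / 4 :=
        mul_le_of_le_one_right (by positivity) (div_le_one_of_le₀ (hδ2.trans hΛ) (by linarith))

lemma rejectionError_le (hκ : 0 ≤ κ) (hδ : 0 < δ) (hδ2 : δ ≤ 1 / 2) (hTV : 0 < δTV)
    (hTV1 : δTV ≤ 1) : rejectionError κ T δ δTV ≤ δ / (T * Real.log (1 / δ)) := by
  have hΛ := half_le_log_one_div hδ hδ2
  refine mul_le_of_le_one_left (by positivity) ?_
  linarith [mul_le_one₀ (acceptanceFloor_le_one hκ) hTV.le hTV1]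

lemma rejectionError_lt_one (hκ : 0 ≤ κ) (hT : 1 ≤ T) (hδ : 0 < δ) (hδ2 : δ ≤ 1 / 2)
    (hTV : 0 < δTV) (hTV1 : δTV ≤ 1) : rejectionError κ T δ δTV < 1 := by
  have hself : rejectionError κ T δ δTV ≤ T * rejectionError κ T δ δTV :=
    le_mul_of_one_le_left (rejectionError_pos hT hδ hδ2 hTV).le (Nat.one_le_cast.2 hT)
  linarith [mul_rejectionError_le (κ := κ) hT hδ hδ2 hTV,
    mul_le_one₀ (acceptanceFloor_le_one hκ) hTV.le hTV1]

lemma mul_sqrt_div_normalizerSamples_le (hκ : 0 ≤ κ) (hT : 1 ≤ T) (hL : 0 < L) (hεκ : ε ≤ κ)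
    (hTV : 0 < δTV) :
    T * (24 * √(L * (1 + ε) / normalizerSamples κ T L δTV)) ≤ acceptanceFloor κ * δTV / 4 := by
  have hβ := acceptanceFloor_pos κ
  have hsamples : L * (1 + κ) * (96 * T / (acceptanceFloor κ * δTV)) ^ 2 ≤
    normalizerSamples κ T L δTV := Nat.le_ceil _
  have hsqrt : √(L * (1 + ε) / normalizerSamples κ T L δTV) ≤
      acceptanceFloor κ * δTV / (96 * T) := by
    refine Real.sqrt_le_iff.2 ⟨by positivity, ?_⟩
    rw [div_le_iff₀ (lt_of_lt_of_le (by positivity) hsamples)]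
    calc L * (1 + ε) ≤ L * (1 + κ) := by gcongr
      _ = (acceptanceFloor κ * δTV / (96 * T)) ^ 2 *
            (L * (1 + κ) * (96 * T / (acceptanceFloor κ * δTV)) ^ 2) := by field_simp
      _ ≤ (acceptanceFloor κ * δTV / (96 * T)) ^ 2 * normalizerSamples κ T L δTV := by gcongr
  calc T * (24 * √(L * (1 + ε) / normalizerSamples κ T L δTV))
      ≤ T * (24 * (acceptanceFloor κ * δTV / (96 * T))) := by gcongr
    _ = acceptanceFloor κ * δTV / 4 := by
        field_simp
        norm_num

lemma le_normalizerSamples (hκ : 0 ≤ κ) (hT : 1 ≤ T) (hL : 0 ≤ L) (hTV : 0 < δTV)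
    (hTV1 : δTV ≤ 1) : L * (1 + κ) ≤ normalizerSamples κ T L δTV := by
  have hβ := acceptanceFloor_pos κ
  have hT' : (1 : ℝ) ≤ T := Nat.one_le_cast.2 hT
  refine (le_mul_of_one_le_right (by positivity) (one_le_pow₀ ?_)).trans (Nat.le_ceil _)
  rw [one_le_div (by positivity)]
  linarith [mul_le_one₀ (acceptanceFloor_le_one hκ) hTV.le hTV1]

lemma one_sub_pow_mixingSteps_le (hκ : 0 ≤ κ) (hTV : 0 < δTV) :
    (1 - acceptanceFloor κ) ^ mixingSteps κ δTV ≤ δTV / 2 := by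
  have hsteps : Real.log (2 / δTV) ≤ mixingSteps κ δTV * acceptanceFloor κ :=
    (div_le_iff₀ (acceptanceFloor_pos κ)).1 (Nat.le_ceil _)
  calc (1 - acceptanceFloor κ) ^ mixingSteps κ δTV
      ≤ Real.exp (-acceptanceFloor κ) ^ mixingSteps κ δTV :=
        pow_le_pow_left₀ (sub_nonneg.2 (acceptanceFloor_le_one hκ)) (Real.one_sub_le_exp_neg _) _
    _ = Real.exp (mixingSteps κ δTV * -acceptanceFloor κ) := (Real.exp_nat_mul _ _).symm
    _ ≤ Real.exp (-Real.log (2 / δTV)) := Real.exp_le_exp.2 (by linarith)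
    _ = δTV / 2 := by rw [Real.exp_neg, Real.exp_log (by positivity), inv_div]

theorem tvDist_target_outputLaw_le (hκ : 0 ≤ κ) (hT : 1 ≤ T) (hL1 : 1 ≤ L) (hε0 : 0 ≤ ε)
    (hεκ : ε ≤ κ / T) (hδ : 0 < δ) (hδ2 : δ ≤ 1 / 2) (hTV : 0 < δTV) (hTV1 : δTV ≤ 1)
    {S : ℕ → Type} {m : ReasoningModel S} {s₀ : S 0} (hL : m.RatioBound s₀ T L)
    (hε : m.BellmanBound s₀ T ε) :
    tvDist (m.target s₀ T hL)
      (m.spgSMCMH s₀ (normalizerSamples κ T L δTV) (envelope κ L) (rejectionError κ T δ δTV) T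
        (mixingSteps κ δTV + 1)).outputLaw ≤ δTV := by
  have hβ := acceptanceFloor_pos κ
  have hεκ' := le_of_le_div_natCast hκ hT hεκ
  have hbound : L * (1 + ε) ≤ L * (1 + κ) := by gcongr
  have hclose := ReasoningModel.tvClose_outerLoop hL hε hβ (acceptanceFloor_le_one hκ)
    (acceptanceFloor_mul_pow_le_one hT hε0 hεκ)
    (hbound.trans (le_normalizerSamples hκ hT (by linarith) hTV hTV1))
    (M := envelope κ L) (mul_le_mul_of_nonneg_left hbound (by norm_num))
    (rejectionError_pos (κ := κ) hT hδ hδ2 hTV) (mixingSteps κ δTV)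
  refine (hclose.symm.mono (ENNReal.ofReal_le_ofReal ?_)).tvDist_le hTV.le
  have hperturb : (T * rejectionError κ T δ δTV +
      T * (24 * √(L * (1 + ε) / normalizerSamples κ T L δTV))) / acceptanceFloor κ ≤ δTV / 2 := by
    rw [div_le_iff₀ hβ]
    linarith [mul_rejectionError_le (κ := κ) hT hδ hδ2 hTV,
      mul_sqrt_div_normalizerSamples_le hκ hT (by linarith : 0 < L) hεκ' hTV]
  linarith [one_sub_pow_mixingSteps_le hκ hTV]

/-! ### The running time -/

lemma log_four_div_rejectionError_le (hκ : 0 ≤ κ) (hT : 1 ≤ T) (hδ : 0 < δ) (hδ2 : δ ≤ 1 / 2)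
    (hTV : 0 < δTV) (hTV1 : δTV ≤ 1) :
    Real.log (4 / rejectionError κ T δ δTV) ≤
      (10 + 4 * κ) * (Real.log (1 / δ) * (1 + Real.log (T / δTV))) := by
  have hX := one_le_natCast_div hT hTV hTV1
  have hX0 := Real.log_nonneg hX
  have hΛ := half_le_log_one_div hδ hδ2
  have hΛδ : Real.log (1 / δ) ≤ 1 / δ := Real.log_le_self (by positivity)
  have hquot : 4 / rejectionError κ T δ δTV ≤
      2 ^ 4 * Real.exp (2 * κ) * (T / δTV) * (1 / δ) ^ 2 := by
    calc 4 / rejectionError κ T δ δTV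
        = 2 ^ 4 * Real.exp (2 * κ) * (T / δTV) * (1 / δ * Real.log (1 / δ)) := by
          rw [rejectionError, acceptanceFloor, Real.exp_neg]
          field_simp
          norm_num
      _ ≤ 2 ^ 4 * Real.exp (2 * κ) * (T / δTV) * (1 / δ) ^ 2 := by
          rw [sq]
          gcongr
  have hlog : Real.log (4 / rejectionError κ T δ δTV) ≤
      4 * Real.log 2 + 2 * κ + Real.log (T / δTV) + 2 * Real.log (1 / δ) := by
    refine (Real.log_le_log (div_pos four_pos (rejectionError_pos hT hδ hδ2 hTV)) hquot).trans_eq ?_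
    rw [Real.log_mul (by positivity) (by positivity), Real.log_mul (by positivity) (by positivity),
      Real.log_mul (by positivity) (by positivity), Real.log_exp, Real.log_pow, Real.log_pow]
    norm_num
  nlinarith [Real.log_two_lt_d9, mul_nonneg (sub_nonneg.2 hΛ) hX0,
    mul_nonneg hκ (mul_nonneg (sub_nonneg.2 hΛ) hX0), mul_nonneg hκ hX0,
    mul_nonneg hκ (sub_nonneg.2 hΛ)]

lemma rejectionTrials_le (hκ : 0 ≤ κ) (hT : 1 ≤ T) (hL : 1 ≤ L) (hδ : 0 < δ) (hδ2 : δ ≤ 1 / 2)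
    (hTV : 0 < δTV) (hTV1 : δTV ≤ 1) :
    (⌈4 * envelope κ L * Real.log (4 / rejectionError κ T δ δTV)⌉₊ : ℝ) ≤
      (16 * (1 + κ) * (10 + 4 * κ) + 2) * (L * Real.log (1 / δ) * (1 + Real.log (T / δTV))) := by
  have hΛ := half_le_log_one_div hδ hδ2
  have hℓ : 1 ≤ 1 + Real.log (T / δTV) :=
    le_add_of_nonneg_right (Real.log_nonneg (one_le_natCast_div hT hTV hTV1))
  have hlog := log_four_div_rejectionError_le hκ hT hδ hδ2 hTV hTV1
  have hlog0 : 0 ≤ Real.log (4 / rejectionError κ T δ δTV) :=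
    Real.log_nonneg <| (one_le_div (rejectionError_pos hT hδ hδ2 hTV)).2 <|
      (rejectionError_lt_one hκ hT hδ hδ2 hTV hTV1).le.trans (by norm_num)
  have hone : 1 ≤ 2 * (L * (Real.log (1 / δ) * (1 + Real.log (T / δTV)))) := by
    nlinarith [one_le_mul_of_one_le_of_one_le hL hℓ]
  calc (⌈4 * envelope κ L * Real.log (4 / rejectionError κ T δ δTV)⌉₊ : ℝ)
      ≤ 4 * envelope κ L * Real.log (4 / rejectionError κ T δ δTV) + 1 :=
        (Nat.ceil_lt_add_one (by unfold envelope; positivity)).le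
    _ ≤ 4 * (4 * (L * (1 + κ))) *
          ((10 + 4 * κ) * (Real.log (1 / δ) * (1 + Real.log (T / δTV)))) +
          2 * (L * (Real.log (1 / δ) * (1 + Real.log (T / δTV)))) := by
        rw [envelope]
        gcongr
    _ = (16 * (1 + κ) * (10 + 4 * κ) + 2) *
          (L * Real.log (1 / δ) * (1 + Real.log (T / δTV))) := by ring

lemma normalizerSamples_le (hκ : 0 ≤ κ) (hT : 1 ≤ T) (hL : 1 ≤ L) (hTV : 0 < δTV)
    (hTV1 : δTV ≤ 1) :
    (normalizerSamples κ T L δTV : ℝ) ≤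
      (9216 * (1 + κ) / acceptanceFloor κ ^ 2 + 1) * (L * (T / δTV) ^ 2) := by
  have hβ := acceptanceFloor_pos κ
  have hone : 1 ≤ L * (T / δTV) ^ 2 :=
    one_le_mul_of_one_le_of_one_le hL (one_le_pow₀ (one_le_natCast_div hT hTV hTV1))
  calc (normalizerSamples κ T L δTV : ℝ)
      ≤ L * (1 + κ) * (96 * T / (acceptanceFloor κ * δTV)) ^ 2 + 1 :=
        (Nat.ceil_lt_add_one (by positivity)).le
    _ ≤ L * (1 + κ) * (96 * T / (acceptanceFloor κ * δTV)) ^ 2 + L * (T / δTV) ^ 2 := by gcongr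
    _ = (9216 * (1 + κ) / acceptanceFloor κ ^ 2 + 1) * (L * (T / δTV) ^ 2) := by
        field_simp
        ring

lemma mixingSteps_add_one_le (κ : ℝ) (hT : 1 ≤ T) (hTV : 0 < δTV) (hTV1 : δTV ≤ 1) :
    (mixingSteps κ δTV : ℝ) + 1 ≤ (1 / acceptanceFloor κ + 2) * (1 + Real.log (T / δTV)) := by
  have hβ := acceptanceFloor_pos κ
  have hX := one_le_natCast_div hT hTV hTV1
  have hT' : (1 : ℝ) ≤ T := Nat.one_le_cast.2 hT
  have hlog0 : 0 ≤ Real.log (2 / δTV) := Real.log_nonneg ((one_le_div hTV).2 (by linarith))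
  have hlog : Real.log (2 / δTV) ≤ 1 + Real.log (T / δTV) := by
    calc Real.log (2 / δTV) ≤ Real.log (2 * (T / δTV)) := by
          rw [← mul_div_assoc]
          gcongr
          linarith
      _ = Real.log 2 + Real.log (T / δTV) := Real.log_mul two_ne_zero (by positivity)
      _ ≤ 1 + Real.log (T / δTV) := by linarith [Real.log_two_lt_d9]
  calc (mixingSteps κ δTV : ℝ) + 1 ≤ Real.log (2 / δTV) / acceptanceFloor κ + 1 + 1 := by
        gcongr
        exact (Nat.ceil_lt_add_one (by positivity)).le
    _ ≤ (1 + Real.log (T / δTV)) / acceptanceFloor κ + 2 * (1 + Real.log (T / δTV)) := by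
        rw [add_assoc]
        gcongr
        linarith [Real.log_nonneg hX]
    _ = (1 / acceptanceFloor κ + 2) * (1 + Real.log (T / δTV)) := by ring

lemma loop_time_le {k N Nm : ℕ} {a₁ a₂ a₃ Λ ℓ : ℝ} (hT : 1 ≤ T) (hL : 1 ≤ L) (hTV : 0 < δTV)
    (hTV1 : δTV ≤ 1) (hΛ : 1 / 2 ≤ Λ) (hℓ : 1 ≤ ℓ) (ha₁ : 0 ≤ a₁) (ha₂ : 0 ≤ a₂)
    (hN : (N : ℝ) ≤ a₁ * (L * Λ * ℓ)) (hNm : (Nm : ℝ) ≤ a₂ * (L * (T / δTV) ^ 2))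
    (hk : (k : ℝ) + 1 ≤ a₃ * ℓ) :
    (((k + 1) * (T * (7 * N + 6 * Nm + 12) + 6) : ℕ) : ℝ) ≤
      a₃ * (7 * a₁ + 12 * a₂ + 36) * (L * (T : ℝ) ^ 3 * Λ / δTV ^ 2) * ℓ ^ 2 := by
  have hT' : (1 : ℝ) ≤ T := Nat.one_le_cast.2 hT
  set Y := L * (T / δTV) ^ 2 with hY
  have hLY : L ≤ Y :=
    le_mul_of_one_le_right (by linarith) (one_le_pow₀ (one_le_natCast_div hT hTV hTV1))
  have hΛℓ : 1 ≤ 2 * (Λ * ℓ) := by nlinarith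
  have hYW : Y ≤ 2 * (Y * (Λ * ℓ)) := by nlinarith
  have htrials : (N : ℝ) ≤ a₁ * (Y * (Λ * ℓ)) := by
    refine hN.trans ?_
    rw [mul_assoc L]
    gcongr
  have hsamples : (Nm : ℝ) ≤ 2 * a₂ * (Y * (Λ * ℓ)) :=
    hNm.trans ((mul_le_mul_of_nonneg_left hYW ha₂).trans_eq (by ring))
  have hiteration : (T : ℝ) * (7 * N + 6 * Nm + 12) + 6 ≤
      T * ((7 * a₁ + 12 * a₂ + 36) * (Y * (Λ * ℓ))) := by
    calc (T : ℝ) * (7 * N + 6 * Nm + 12) + 6 ≤ T * (7 * N + 6 * Nm + 18) := by linarith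
      _ ≤ T * ((7 * a₁ + 12 * a₂ + 36) * (Y * (Λ * ℓ))) := by
          gcongr
          linarith
  push_cast
  calc ((k : ℝ) + 1) * (T * (7 * N + 6 * Nm + 12) + 6)
      ≤ a₃ * ℓ * (T * ((7 * a₁ + 12 * a₂ + 36) * (Y * (Λ * ℓ)))) :=
        mul_le_mul hk hiteration (by positivity) ((by positivity : (0 : ℝ) ≤ k + 1).trans hk)
    _ = a₃ * (7 * a₁ + 12 * a₂ + 36) * (L * (T : ℝ) ^ 3 * Λ / δTV ^ 2) * ℓ ^ 2 := by
        rw [hY]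
        field_simp

/-- The constant `C` of the theorem: the first summand bounds the running time, the second one
the envelope. -/
noncomputable def costConst (κ : ℝ) : ℝ :=
  (1 / acceptanceFloor κ + 2) * (7 * (16 * (1 + κ) * (10 + 4 * κ) + 2) +
    12 * (9216 * (1 + κ) / acceptanceFloor κ ^ 2 + 1) + 36) + 4 * (1 + κ)

lemma one_le_costConst (hκ : 0 ≤ κ) : 1 ≤ costConst κ := by
  have hβ := acceptanceFloor_pos κ
  unfold costConst
  refine le_add_of_nonneg_of_le (by positivity) ?_
  linarith

lemma envelope_le (hκ : 0 ≤ κ) (hL : 0 ≤ L) : envelope κ L ≤ costConst κ * L := by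
  have hβ := acceptanceFloor_pos κ
  calc envelope κ L = 4 * (1 + κ) * L := by rw [envelope]; ring
    _ ≤ costConst κ * L := by
        gcongr
        exact le_add_of_nonneg_left (by positivity)

lemma mul_one_add_lt_envelope (hκ : 0 ≤ κ) (hL : 0 < L) (hεκ : ε ≤ κ) :
    L * (1 + ε) < envelope κ L := by
  have hbound : L * (1 + ε) ≤ L * (1 + κ) := by gcongr
  have hpos : 0 < L * (1 + κ) := by positivity
  unfold envelope
  linarith

theorem time_le (hκ : 0 ≤ κ) (hT : 1 ≤ T) (hL : 1 ≤ L) (hδ : 0 < δ) (hδ2 : δ ≤ 1 / 2)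
    (hTV : 0 < δTV) (hTV1 : δTV ≤ 1) {S : ℕ → Type} (m : ReasoningModel S) (s₀ : S 0)
    (r : (m.spgSMCMH s₀ (normalizerSamples κ T L δTV) (envelope κ L) (rejectionError κ T δ δTV) T
      (mixingSteps κ δTV + 1)).Run) :
    ((m.spgSMCMH s₀ (normalizerSamples κ T L δTV) (envelope κ L) (rejectionError κ T δ δTV) T
      (mixingSteps κ δTV + 1)).time r : ℝ) ≤
      costConst κ * (L * (T : ℝ) ^ 3 * Real.log (1 / δ) / δTV ^ 2) *
        (1 + Real.log (T / δTV)) ^ 2 := by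
  have hβ := acceptanceFloor_pos κ
  have hΛ := half_le_log_one_div hδ hδ2
  have hℓ : 1 ≤ 1 + Real.log (T / δTV) :=
    le_add_of_nonneg_right (Real.log_nonneg (one_le_natCast_div hT hTV hTV1))
  refine (Nat.cast_le.2 (m.timeLE_outerLoop s₀ _ _ _ T _ r)).trans <|
    (loop_time_le hT hL hTV hTV1 hΛ hℓ (by positivity) (by positivity)
      (rejectionTrials_le hκ hT hL hδ hδ2 hTV hTV1) (normalizerSamples_le hκ hT hL hTV hTV1)
      (mixingSteps_add_one_le κ hT hTV hTV1)).trans ?_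
  gcongr
  exact le_add_of_nonneg_right (by positivity)

end SPgSMC

theorem mainTheorem10_general (κ : ℝ) (hκ : 0 ≤ κ) :
    ∃ (C : ℝ) (p : ℕ), 0 < C ∧
      ∀ (T : ℕ) (L ε δ δTV : ℝ), 1 ≤ T → 1 ≤ L → 0 ≤ ε → ε ≤ κ / T →
        0 < δTV → δTV ≤ 1 → 0 < δ → δ ≤ 1 / 2 →
        ∃ (H Nm : ℕ) (M δRS : ℝ), 1 ≤ H ∧ 1 ≤ Nm ∧ L * (1 + ε) < M ∧ M ≤ C * L ∧
          0 < δRS ∧ δRS < 1 ∧ δRS ≤ C * (δ / (T * Real.log (1 / δ))) ∧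
          ∀ (S : ℕ → Type) (m : ReasoningModel S) (s₀ : S 0)
            (hL : m.RatioBound s₀ T L), m.BellmanBound s₀ T ε →
            (∀ r : (m.spgSMCMH s₀ Nm M δRS T H).Run,
              ((m.spgSMCMH s₀ Nm M δRS T H).time r : ℝ) ≤
                C * (L * (T : ℝ) ^ 3 * Real.log (1 / δ) / δTV ^ 2) *
                  (1 + Real.log (T / δTV)) ^ p) ∧
            tvDist (m.target s₀ T hL) (m.spgSMCMH s₀ Nm M δRS T H).outputLaw ≤ δTV := by
  have hC : 1 ≤ SPgSMC.costConst κ := SPgSMC.one_le_costConst hκ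
  refine ⟨SPgSMC.costConst κ, 2, one_pos.trans_le hC, ?_⟩
  intro T L ε δ δTV hT hL1 hε0 hεκ hTV hTV1 hδ hδ2
  have hL0 : 0 < L := one_pos.trans_le hL1
  have hΛ := SPgSMC.half_le_log_one_div hδ hδ2
  refine ⟨SPgSMC.mixingSteps κ δTV + 1, SPgSMC.normalizerSamples κ T L δTV,
    SPgSMC.envelope κ L, SPgSMC.rejectionError κ T δ δTV, Nat.succ_pos _, ?_,
    SPgSMC.mul_one_add_lt_envelope hκ hL0 (SPgSMC.le_of_le_div_natCast hκ hT hεκ),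
    SPgSMC.envelope_le hκ hL0.le, SPgSMC.rejectionError_pos hT hδ hδ2 hTV,
    SPgSMC.rejectionError_lt_one hκ hT hδ hδ2 hTV hTV1, ?_, ?_⟩
  · exact Nat.cast_pos.1 <| (by positivity : 0 < L * (1 + κ)).trans_le
      (SPgSMC.le_normalizerSamples hκ hT hL0.le hTV hTV1)
  · exact (SPgSMC.rejectionError_le hκ hδ hδ2 hTV hTV1).trans
      (le_mul_of_one_le_left (by positivity) hC)
  · exact fun S m s₀ hL hε => ⟨SPgSMC.time_le hκ hT hL1 hδ hδ2 hTV hTV1 m s₀,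
      SPgSMC.tvDist_target_outputLaw_le hκ hT hL1 hε0 hεκ hδ hδ2 hTV hTV1 hL hε⟩

theorem mainTheorem10 (κ c₀ : ℝ) (hκ : 0 < κ) (hc₀ : 0 < c₀) :
    ∃ (C : ℝ) (p : ℕ), 0 < C ∧
      ∀ (T : ℕ) (L ε δ δTV : ℝ), 1 ≤ T → 1 ≤ L → 0 < ε → ε ≤ κ / T →
        0 < δTV → δTV ≤ 1 → 0 < δ → δ ≤ c₀ * δTV → δ ≤ 1 / 2 →
        ∃ (H Nm : ℕ) (M δRS : ℝ), 1 ≤ H ∧ 1 ≤ Nm ∧ L * (1 + ε) < M ∧ M ≤ C * L ∧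
          0 < δRS ∧ δRS < 1 ∧ δRS ≤ C * (δ / (T * Real.log (1 / δ))) ∧
          ∀ (S : ℕ → Type) (m : ReasoningModel S) (s₀ : S 0)
            (hL : m.RatioBound s₀ T L), m.BellmanBound s₀ T ε →
            (∀ r : (m.spgSMCMH s₀ Nm M δRS T H).Run,
              ((m.spgSMCMH s₀ Nm M δRS T H).time r : ℝ) ≤
                C * (L * (T : ℝ) ^ 3 * Real.log (1 / δ) / δTV ^ 2) *
                  (1 + Real.log (T / δTV)) ^ p) ∧
            ∃ (E : Set (m.spgSMCMH s₀ Nm M δRS T H).Run)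
              (hE : ∃ r ∈ E, r ∈ (m.spgSMCMH s₀ Nm M δRS T H).law.support),
              1 - δ ≤ prob (m.spgSMCMH s₀ Nm M δRS T H).law E ∧
              tvDist (m.target s₀ T hL)
                ((m.spgSMCMH s₀ Nm M δRS T H).outputGiven E hE) ≤ δTV := by
  obtain ⟨C, p, hC, hgeneral⟩ := mainTheorem10_general κ hκ.le
  refine ⟨C, p, hC, fun T L ε δ δTV hT hL1 hε0 hεκ hTV hTV1 hδ _ hδ2 => ?_⟩
  obtain ⟨H, Nm, M, δRS, hH, hNm, hM, hMC, hδRS, hδRS1, hδRSC, hrun⟩ :=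
    hgeneral T L ε δ δTV hT hL1 hε0.le hεκ hTV hTV1 hδ hδ2
  refine ⟨H, Nm, M, δRS, hH, hNm, hM, hMC, hδRS, hδRS1, hδRSC, fun S m s₀ hL hε => ?_⟩
  obtain ⟨htime, hdist⟩ := hrun S m s₀ hL hε
  exact ⟨htime, Prog.exists_tvDist_outputGiven_le _ hδ.le hdist⟩
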